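/- For an integer $m\ge 1$ and $0\le i,j\le m-1$ let $S_{i,j,m}=[\frac im,\frac{i+1}m]\times[\frac jm,\frac{j+1}m]$ be the square in column $i$ and row $j$ of the $m\times m$ grid on the unit square (columns counted from the left, rows from the bottom, both starting with $0$). For $k\ge 1$ the $k$-th (right) snake cross pattern $\mathcal A_k$ is the following set of squares (called white) of the $m_k\times m_k$ grid, $m_k=4k+7$. It contains the central square, in column and row $2k+3$; below, $(u,v)$ stands for the square in column $2k+3+u$ and row $2k+3+v$. Put $t_0=t_{k+1}=0$ and $t_j=(-1)^{j+1}(2j-1)$ for $1\le j\le k$. The upper arm consists of the squares $(t_j,2j+1)$ for $0\le j\le k+1$ and of the squares $(u,2j+2)$ for $0\le j\le k$ and all integers $u$ between $t_j$ and $t_{j+1}$ (inclusive). Then $\mathcal A_k$ consists of the central square, the upper arm, and the three images of the upper arm under the rotations by $90^\circ$, $180^\circ$ and $270^\circ$ about the central square. Let $\mathcal W_1=\mathcal A_1$ and, for $n\ge 2$, let $\mathcal W_n$ be the set of all squares that are obtained by scaling the pattern $\mathcal A_n$ into the squares of $\mathcal W_{n-1}$, that is, $\mathcal W_n=\{P_Q(W):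 Q\in\mathcal W_{n-1},\ W\in\mathcal A_n\}$, where for $Q=[x,x+q]\times[y,y+q]$ the map $P_Q$ is $P_Q(z_1,z_2)=(qz_1+x,\,qz_2+y)$. Let $L_n=\bigcup_{W\in\mathcal W_n}W$ and let $L_\infty=\bigcap_{n\ge 1}L_n$ be the mixed labyrinth fractal generated by the sequence $(\mathcal A_k)_{k\ge1}$. **Theorem.** For any two distinct points $x,y\in L_\infty$ there is a unique arc (homeomorphic image of $[0,1]$) in $L_\infty$ with end points $x$ and $y$, and this arc $a(x,y)$ has box-counting dimension $$\dim_B a(x,y)=\lim_{\delta\to0^+}\frac{\log N_\delta(a(x,y))}{-\log\delta}=2,$$ where $N_\delta(F)$ is the least number of closed discs of radius $\delta$ that cover $F$; in particular the limit exists. -/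

import Mathlib

open Set Filter Topology
open scoped NNReal ENNReal

namespace Labyrinth

/-- The Euclidean plane. -/
abbrev Plane : Type := EuclideanSpace ℝ (Fin 2)

/-- The closed square `S_{i,j,M}` of the `M × M` grid on the unit square, in column `i` (counted
from the left, starting with `0`) and row `j` (counted from the bottom, starting with `0`). -/
def gridSquare (M : ℕ) (c : ℤ × ℤ) : Set Plane :=
  {p | (c.1 : ℝ) / M ≤ p 0 ∧ p 0 ≤ ((c.1 : ℝ) + 1) / M ∧
       (c.2 : ℝ) / M ≤ p 1 ∧ p 1 ≤ ((c.2 : ℝ) + 1) / M}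

/-- `m(n) = m_1 m_2 ⋯ m_n`. -/
def totalWidth (m : ℕ → ℕ) (n : ℕ) : ℕ := ∏ k ∈ Finset.Icc 1 n, m k

/-- The positions `(column, row)` in the `m(n) × m(n)` grid of the white squares of level `n`,
for a sequence of patterns `A 1, A 2, …` of widths `m 1, m 2, …`; a pattern is given by the
positions of its white squares. Level `0` is the unit square itself; a white square of level
`n + 1` is a white square of the pattern `A (n + 1)`, scaled into a white square of level `n`:
if `Q = S_{a,b,M}` then `P_Q (S_{i,j,m}) = S_{m a + i, m b + j, m M}`. -/
def whiteSquares (m : ℕ → ℕ) (A : ℕ → Set (ℤ × ℤ)) : ℕ → Set (ℤ × ℤ)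
  | 0 => {(0, 0)}
  | n + 1 => {c | ∃ q ∈ whiteSquares m A n, ∃ w ∈ A (n + 1),
      c = (m (n + 1) * q.1 + w.1, m (n + 1) * q.2 + w.2)}

/-- `L_n`, the union of the white squares of level `n`. -/
def levelSet (m : ℕ → ℕ) (A : ℕ → Set (ℤ × ℤ)) (n : ℕ) : Set Plane :=
  ⋃ c ∈ whiteSquares m A n, gridSquare (totalWidth m n) c

/-- `L_∞`, the limit set generated by the sequence of patterns. -/
def limitSet (m : ℕ → ℕ) (A : ℕ → Set (ℤ × ℤ)) : Set Plane :=
  ⋂ n ∈ Ici 1, levelSet m A n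

/-- The width `m_k = 4 k + 7` of the `k`-th snake cross pattern. -/
def snakeWidth (k : ℕ) : ℕ := 4 * k + 7

/-- The horizontal position, relative to the central square, of the upper arm of the `k`-th snake
cross pattern after `j` of its `k + 1` horizontal runs. The arm starts above the central square;
the runs go alternately to the right and to the left, the `j`-th one (`1 ≤ j ≤ k`) ending at
`1, -3, 5, -7, …`, next to a diagonal; the last run ends below the exit, at `0`. -/
def snakeTurn (k j : ℕ) : ℤ :=
  if j = 0 ∨ j = k + 1 then 0 else (-1) ^ (j + 1) * (2 * (j : ℤ) - 1)

/-- The upper arm of the `k`-th (right) snake cross pattern, in coordinates relative to the central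
square `(0, 0)`. Seen from the central square: two steps up (to height `2`), a run to the right, two
steps up, a run to the left, two steps up, …, until the square `(0, 2 k + 2)` below the exit square
`(0, 2 k + 3)` is reached. The horizontal runs are at the heights `2 j + 2` (`0 ≤ j ≤ k`); the
squares at the odd heights `2 j + 1` (`0 ≤ j ≤ k + 1`) link the central square, the runs and the
exit square. -/
def snakeArm (k : ℕ) : Set (ℤ × ℤ) :=
  {c | ∃ j : ℕ, j ≤ k + 1 ∧ c.1 = snakeTurn k j ∧ c.2 = 2 * (j : ℤ) + 1} ∪
  {c | ∃ j : ℕ, j ≤ k ∧ c.1 ∈ uIcc (snakeTurn k j) (snakeTurn k (j + 1)) ∧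
    c.2 = 2 * (j : ℤ) + 2}

/-- The `k`-th snake cross pattern: the central square `(2 k + 3, 2 k + 3)` of the
`(4 k + 7) × (4 k + 7)` grid together with the upper arm and its images under the
rotations by `90`, `180` and `270` degrees about the central square. -/
def snakeCross (k : ℕ) : Set (ℤ × ℤ) :=
  {c | ∃ u v : ℤ, c = (2 * (k : ℤ) + 3 + u, 2 * (k : ℤ) + 3 + v) ∧
    ((u, v) = (0, 0) ∨ (u, v) ∈ snakeArm k ∨ (v, -u) ∈ snakeArm k ∨
      (-u, -v) ∈ snakeArm k ∨ (-v, u) ∈ snakeArm k)}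

/-- The mixed labyrinth fractal generated by the sequence of snake cross patterns. -/
def snakeFractal : Set Plane := limitSet snakeWidth snakeCross

/-- `a` is an arc with end points `x` and `y`: the image of an injective path from `x` to `y`. -/
def IsArc (x y : Plane) (a : Set Plane) : Prop :=
  ∃ γ : Path x y, Function.Injective γ ∧ range γ = a

/-- `dim_B F = d`: the limit of `log N_δ(F) / (-log δ)` as `δ → 0⁺` exists and is `d`, where
`N_δ(F)` is the least number of closed balls of radius `δ` that cover `F`. -/
def HasBoxDim (F : Set Plane) (d : ℝ) : Prop :=
  Tendsto (fun δ : ℝ≥0 =>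
      ENNReal.log ((Metric.externalCoveringNumber δ F : ℕ∞) : ℝ≥0∞) /
        ((-Real.log (δ : ℝ) : ℝ) : EReal))
    (𝓝[>] 0) (𝓝 (d : EReal))

end Labyrinth

/-! Each pattern is a tree of squares that meets the border only in the four side middles, and every
edge of it cuts exactly one exit off from the other three (`IsCross`, `isCross_snakeCross`).
Substituting such a pattern into a tree of squares gives a tree again
(`IsCross.gridConnected_substitution`, `IsCross.gridAcyclic_substitution`), so every level is a
tree. A point of the fractal on a grid line is the middle of a grid edge, since its offset from the
middle would at least double from level to level (`exists_half_int`). Hence two squares of one level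
share at most one point of the fractal, and every edge of a level tree yields a cut point of the
fractal.

These countably many cut points separate any two points (`exists_separates_edgePoints`). In a
compact connected Hausdorff space this suffices for arcs: the separators of `x` and `y` form a
countable dense order without ends, Cantor's theorem labels them by the rationals in `(0, 1)`, and
the labels extend to a continuous function that maps the closure of the separators homeomorphically
onto `[0, 1]` (`exists_injective_path`). Every arc from `x` to `y` equals that closure
(`range_eq_closure_separators`), whence uniqueness.

For the dimension, `2` is an upper bound for any subset of the unit square. Conversely, a connected
set that joins two side middles of a square of level `n` has to run through the winding arm towards
one of them, and so crosses at least `n ^ 2` of its subsquares (`sq_mul_ncard_crossedSquares_le`).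
As the widths grow only linearly, `n ^ 2` eventually beats the power `s` of the width for each `s <
2`, even of the width one level further on. The number of crossed squares of level `n` is therefore
at least a multiple of `m(n + 1) ^ s`, which serves all radii between `1 / m(n + 1)` and `1 / m(n)`.
Of the arc, only connectedness and two distinct points are used here. -/

namespace Labyrinth

/-! ### Separation by points, and arcs in dendrite-like spaces -/

section Dendrite

variable {X : Type*} [TopologicalSpace X]

/-- `U` and `V` are open and disjoint, and their union is the complement of the point `p`. -/
def IsSplit (p : X) (U V : Set X) : Prop :=
  IsOpen U ∧ IsOpen V ∧ Disjoint U V ∧ U ∪ V = {p}ᶜ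

/-- The point `p` separates `x` from `y`. -/
def Separates (p x y : X) : Prop := ∃ U V, IsSplit p U V ∧ x ∈ U ∧ y ∈ V

namespace IsSplit

variable {p : X} {U V : Set X}

lemma symm (h : IsSplit p U V) : IsSplit p V U :=
  ⟨h.2.1, h.1, h.2.2.1.symm, by rw [union_comm, h.2.2.2]⟩

lemma notMem_left (h : IsSplit p U V) : p ∉ U := fun hp => by
  have : p ∈ U ∪ V := Or.inl hp
  rw [h.2.2.2] at this
  exact this rfl

lemma notMem_right (h : IsSplit p U V) : p ∉ V := h.symm.notMem_left

lemma mem_or (h : IsSplit p U V) {z : X} (hz : z ≠ p) : z ∈ U ∨ z ∈ V := by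
  have : z ∈ U ∪ V := by rw [h.2.2.2]; exact hz
  exact this

lemma notMem_of_mem (h : IsSplit p U V) {z : X} (hz : z ∈ U) : z ∉ V :=
  fun hz' => h.2.2.1.le_bot ⟨hz, hz'⟩

lemma notMem_insert {q : X} (h : IsSplit p U V) (hq : q ∈ V) :
    q ∉ insert p U := by
  rintro (rfl | hq')
  · exact h.notMem_right hq
  · exact h.notMem_of_mem hq' hq

/-- A preconnected set meeting both sides contains the splitting point. -/
lemma mem_of_isPreconnected (h : IsSplit p U V) {T : Set X} (hT : IsPreconnected T) {a b : X}
    (ha : a ∈ T) (haU : a ∈ U) (hb : b ∈ T) (hbV : b ∈ V) : p ∈ T := by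
  by_contra hp
  have hsub : T ⊆ U ∪ V := fun z hz => h.mem_or (fun e => hp (e ▸ hz))
  obtain ⟨z, -, hzU, hzV⟩ := hT U V h.1 h.2.1 hsub ⟨a, ha, haU⟩ ⟨b, hb, hbV⟩
  exact h.notMem_of_mem hzU hzV

/-- In a connected space each side, together with the splitting point, is connected. -/
lemma isPreconnected_insert [PreconnectedSpace X] (h : IsSplit p U V) :
    IsPreconnected (insert p U) := by
  -- Closed as the complement of the open set `V`, so no separation axiom on `X` is needed.
  have hcl : IsClosed (insert p U) := by
    have : insert p U = Vᶜ := by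
      ext z
      constructor
      · rintro (rfl | hz)
        · exact h.notMem_right
        · exact h.notMem_of_mem hz
      · intro hz
        by_cases hzp : z = p
        · exact Or.inl hzp
        · exact Or.inr ((h.mem_or hzp).resolve_right hz)
    rw [this]
    exact h.2.1.isClosed_compl
  rw [isPreconnected_closed_iff]
  intro F G hF hG hFG hF' hG'
  by_contra hne
  rw [not_nonempty_iff_eq_empty] at hne
  -- The piece in `G`, which misses `p`, is closed and also equal to the open set `U ∩ Fᶜ`; a
  -- nonempty clopen set is the whole space and would contain `p`.
  have key : ∀ F G : Set X, IsClosed F → IsClosed G → insert p U ⊆ F ∪ G →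
      (insert p U ∩ (F ∩ G)) = ∅ → p ∈ F → (insert p U ∩ G).Nonempty → False := by
    intro F G hF hG hFG hne hpF hG'
    have hpG : p ∉ G := fun hpG => by
      have : p ∈ insert p U ∩ (F ∩ G) := ⟨Or.inl rfl, hpF, hpG⟩
      rw [hne] at this; exact this
    have h1 : IsClosed (insert p U ∩ G) := hcl.inter hG
    have h2 : insert p U ∩ G = U ∩ Fᶜ := by
      ext z
      constructor
      · rintro ⟨hz | hz, hzG⟩
        · exact absurd (hz ▸ hzG) hpG
        · refine ⟨hz, fun hzF => ?_⟩
          have : z ∈ insert p U ∩ (F ∩ G) := ⟨Or.inr hz, hzF, hzG⟩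
          rw [hne] at this; exact this
      · rintro ⟨hz, hzF⟩
        exact ⟨Or.inr hz, (hFG (Or.inr hz)).resolve_left hzF⟩
    have h3 : IsClopen (insert p U ∩ G) := ⟨h1, by rw [h2]; exact h.1.inter hF.isOpen_compl⟩
    rcases isClopen_iff.1 h3 with h4 | h4
    · rw [h4] at hG'; exact not_nonempty_empty hG'
    · have : p ∈ insert p U ∩ G := by rw [h4]; trivial
      exact hpG this.2
  rcases hFG (mem_insert p U) with hp | hp
  · exact key F G hF hG hFG hne hp hG'
  · exact key G F hG hF (by rwa [union_comm]) (by rwa [inter_comm G F]) hp hF'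

end IsSplit

namespace Separates

variable {p q r x y z : X}

lemma symm (h : Separates p x y) : Separates p y x := by
  obtain ⟨U, V, h, hx, hy⟩ := h
  exact ⟨V, U, h.symm, hy, hx⟩

lemma ne_left (h : Separates p x y) : x ≠ p := by
  obtain ⟨U, V, h, hx, hy⟩ := h
  rintro rfl
  exact h.notMem_left hx

lemma ne_right (h : Separates p x y) : y ≠ p := h.symm.ne_left

lemma mem_of_isPreconnected (h : Separates p x y) {T : Set X} (hT : IsPreconnected T)
    (hx : x ∈ T) (hy : y ∈ T) : p ∈ T := by
  obtain ⟨U, V, h, hxU, hyV⟩ := h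
  exact h.mem_of_isPreconnected hT hx hxU hy hyV

variable [PreconnectedSpace X]

/-- A side of a splitting at `p` is not split by a point `q` outside. -/
lemma _root_.Labyrinth.IsSplit.not_separates {U V : Set X} (h : IsSplit p U V) (hq : q ∉ insert p U)
    (hx : x ∈ insert p U) (hy : y ∈ insert p U) : ¬ Separates q x y :=
  fun hs => hq (hs.mem_of_isPreconnected h.isPreconnected_insert hx hy)

/-- The side of `x` at `p`, together with `p`, is connected and misses `q`. -/
lemma asymm (h : Separates p x q) : ¬ Separates q x p := by
  obtain ⟨U, V, h, hx, hq⟩ := h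
  exact h.not_separates (h.notMem_insert hq) (Or.inr hx) (Or.inl rfl)

/-- If `p` separates `x` from `q` and `q` separates `x` from `r`, then any splitting of the first
kind has `r` on the side of `q`. -/
lemma _root_.Labyrinth.IsSplit.mem_of_separates {U V : Set X} (h : IsSplit p U V) (hx : x ∈ U)
    (hq : q ∈ V) (hqr : Separates q x r) : r ∈ V := by
  by_contra hr
  refine h.not_separates (h.notMem_insert hq) (Or.inr hx) ?_ hqr
  by_cases hrp : r = p
  · exact Or.inl hrp
  · exact Or.inr ((h.mem_or hrp).resolve_right hr)

lemma trans (h : Separates p x q) (h' : Separates q x r) : Separates p x r := by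
  obtain ⟨U, V, h, hx, hq⟩ := h
  exact ⟨U, V, h, hx, h.mem_of_separates hx hq h'⟩

/-- If `q` is on the side of `x` at `p`, then the other side with `p` added is connected and misses
`q`. So `q` cannot part `p` from `y`, and `p` lies beyond `q`. -/
lemma total (hp : Separates p x y) (hq : Separates q x y) (hpq : p ≠ q) :
    Separates p x q ∨ Separates q x p := by
  obtain ⟨U, V, h, hx, hy⟩ := hp
  rcases h.mem_or hpq.symm with hqU | hqV
  · right
    obtain ⟨U', V', h', hx', hy'⟩ := hq
    refine ⟨U', V', h', hx', ?_⟩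
    by_contra hpV
    have hpU := (h'.mem_or hpq).resolve_right hpV
    have : Separates q p y := ⟨U', V', h', hpU, hy'⟩
    exact h.symm.not_separates (h.symm.notMem_insert hqU) (Or.inl rfl) (Or.inr hy) this
  · exact Or.inl ⟨U, V, h, hx, hqV⟩

end Separates

variable [PreconnectedSpace X] {D : Set X}

/-- The source of density and of the absence of end points. A point that separates `p` from `q` must
lie in `V`, because `insert p V` is connected; it then has `x` and `p` on the same side, because
`insert p U` is connected. -/
lemma IsSplit.exists_between (hD : ∀ x y : X, x ≠ y → ∃ p ∈ D, Separates p x y) {p q x : X}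
    {U V : Set X} (h : IsSplit p U V) (hx : x ∈ U) (hq : q ∈ V) :
    ∃ r ∈ D, r ∈ V ∧ Separates r x q := by
  have hpq : p ≠ q := by rintro rfl; exact h.notMem_right hq
  obtain ⟨r, hrD, hr⟩ := hD p q hpq
  have hrV : r ∈ V := by
    by_contra hrV
    have hrU := (h.mem_or hr.ne_left.symm).resolve_right hrV
    exact h.symm.not_separates (h.symm.notMem_insert hrU) (Or.inl rfl) (Or.inr hq) hr
  refine ⟨r, hrD, hrV, ?_⟩
  obtain ⟨U', V', h', hp', hq'⟩ := hr
  refine ⟨U', V', h', ?_, hq'⟩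
  by_contra hxU
  have hxr : x ≠ r := by rintro rfl; exact h.notMem_of_mem hx hrV
  have hxV : x ∈ V' := (h'.mem_or hxr).resolve_left hxU
  exact h.not_separates (h.notMem_insert hrV) (Or.inl rfl) (Or.inr hx) ⟨U', V', h', hp', hxV⟩

/-- The points of `D` that separate `x` from `y`. -/
def separators (D : Set X) (x y : X) : Set X := {p ∈ D | Separates p x y}

open Classical in
/-- The separators of `x` and `y`, ordered from `x` to `y`. -/
noncomputable abbrev separatorsOrder (D : Set X) (x y : X) : LinearOrder (separators D x y) where
  le p q := p = q ∨ Separates (p : X) x q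
  lt p q := Separates (p : X) x q
  le_refl p := Or.inl rfl
  le_trans p q r := by
    rintro (rfl | h) (rfl | h')
    · exact Or.inl rfl
    · exact Or.inr h'
    · exact Or.inr h
    · exact Or.inr (h.trans h')
  lt_iff_le_not_ge p q := by
    constructor
    · intro h
      refine ⟨Or.inr h, ?_⟩
      rintro (rfl | h')
      · exact h.ne_right rfl
      · exact h.asymm h'
    · rintro ⟨rfl | h, h'⟩
      · exact absurd (Or.inl rfl) h'
      · exact h
  le_antisymm p q := by
    rintro (rfl | h) (h' | h')
    · rfl
    · rfl
    · exact h'.symm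
    · exact absurd h' h.asymm
  le_total p q := by
    by_cases hpq : p = q
    · exact Or.inl (Or.inl hpq)
    · rcases p.2.2.total q.2.2 (fun e => hpq (Subtype.ext e)) with h | h
      · exact Or.inl (Or.inr h)
      · exact Or.inr (Or.inr h)
  toDecidableLE := Classical.decRel _

/-- The separators of two points, in their order, form a copy of the rationals. -/
lemma exists_separators_parametrization (hDc : D.Countable)
    (hD : ∀ x y : X, x ≠ y → ∃ p ∈ D, Separates p x y) {x y : X} (hxy : x ≠ y) :
    ∃ φ : X → ℝ, (∀ p ∈ separators D x y, 0 < φ p ∧ φ p < 1) ∧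
      (∀ p ∈ separators D x y, ∀ q ∈ separators D x y, Separates p x q ↔ φ p < φ q) ∧
      ∀ a b : ℝ, 0 ≤ a → a < b → b ≤ 1 → ∃ p ∈ separators D x y, a < φ p ∧ φ p < b := by
  classical
  let _ : LinearOrder (separators D x y) := separatorsOrder D x y
  have hlt : ∀ p q : separators D x y, p < q ↔ Separates (p : X) x q := fun p q => Iff.rfl
  have : Countable (separators D x y) := (hDc.mono (sep_subset _ _)).to_subtype
  have : Nonempty (separators D x y) := by
    obtain ⟨p, hp, h⟩ := hD x y hxy
    exact ⟨⟨p, hp, h⟩⟩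
  have : DenselyOrdered (separators D x y) := ⟨by
    intro p q hpq
    obtain ⟨U, V, h, hx, hq⟩ := (hlt p q).1 hpq
    obtain ⟨r, hr, hrV, hrq⟩ := h.exists_between hD hx hq
    exact ⟨⟨r, hr, hrq.trans q.2.2⟩, ⟨U, V, h, hx, hrV⟩, hrq⟩⟩
  have : NoMinOrder (separators D x y) := ⟨by
    intro p
    obtain ⟨r, hr, hrp⟩ := hD x p p.2.2.ne_left
    exact ⟨⟨r, hr, hrp.trans p.2.2⟩, hrp⟩⟩
  have : NoMaxOrder (separators D x y) := ⟨by
    intro p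
    obtain ⟨U, V, h, hx, hy⟩ := p.2.2
    obtain ⟨r, hr, hrV, hry⟩ := h.exists_between hD hx hy
    exact ⟨⟨r, hr, hry⟩, ⟨U, V, h, hx, hrV⟩⟩⟩
  have : Nonempty (Ioo (0 : ℚ) 1) := nonempty_Ioo_subtype one_pos
  -- Cantor's theorem. With the rationals of `(0, 1)` as the target, the labels are dense in `[0,
  -- 1]`.
  obtain ⟨e⟩ := Order.iso_of_countable_dense (separators D x y) (Ioo (0 : ℚ) 1)
  -- The value `0` off the separators is arbitrary: all three properties speak only of separators.
  refine ⟨fun p => if h : p ∈ separators D x y then ((e ⟨p, h⟩ : ℚ) : ℝ) else 0, ?_, ?_, ?_⟩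
  · intro p hp
    simp only [hp, dif_pos]
    exact ⟨by exact_mod_cast (e ⟨p, hp⟩).2.1, by exact_mod_cast (e ⟨p, hp⟩).2.2⟩
  · intro p hp q hq
    simp only [hp, hq, dif_pos, Rat.cast_lt, Subtype.coe_lt_coe, e.lt_iff_lt]
    exact (hlt ⟨p, hp⟩ ⟨q, hq⟩).symm
  · intro a b ha hab hb
    obtain ⟨s, hs1, hs2⟩ := exists_rat_btwn hab
    have hs : s ∈ Ioo (0 : ℚ) 1 :=
      ⟨by exact_mod_cast ha.trans_lt hs1, by exact_mod_cast hs2.trans_le hb⟩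
    refine ⟨e.symm ⟨s, hs⟩, (e.symm ⟨s, hs⟩).2, ?_⟩
    simp [hs1, hs2]

variable {x y : X}

/-- Both open sides contain a separator of `x` and `y`. A separator in `U` forbids that `x` and `y`
both lie in the connected set `insert p V` that avoids it, and likewise with the sides exchanged. -/
lemma IsSplit.separates_of_mem_closure {p z w : X} {U V : Set X} (h : IsSplit p U V)
    (hz : z ∈ closure (separators D x y)) (hw : w ∈ closure (separators D x y))
    (hzU : z ∈ U) (hwV : w ∈ V) : (x ∈ U ∧ y ∈ V) ∨ (x ∈ V ∧ y ∈ U) := by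
  obtain ⟨s, hsU, hs⟩ := mem_closure_iff.1 hz U h.1 hzU
  obtain ⟨t, htV, ht⟩ := mem_closure_iff.1 hw V h.2.1 hwV
  have key : ∀ {U V : Set X} {s : X}, IsSplit p U V → s ∈ U → Separates s x y →
      x ∈ insert p V → y ∈ insert p V → False := by
    intro U V s h hs hsep hx hy
    exact h.symm.not_separates (h.symm.notMem_insert hs) hx hy hsep
  have hor : ∀ v, v = p ∨ v ∈ U ∨ v ∈ V := fun v => by
    by_cases hv : v = p
    · exact Or.inl hv
    · exact Or.inr (h.mem_or hv)
  rcases hor x with hx | hx | hx <;> rcases hor y with hy | hy | hy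
  · exact (key h hsU hs.2 (Or.inl hx) (Or.inl hy)).elim
  · exact (key h.symm htV ht.2 (Or.inl hx) (Or.inr hy)).elim
  · exact (key h hsU hs.2 (Or.inl hx) (Or.inr hy)).elim
  · exact (key h.symm htV ht.2 (Or.inr hx) (Or.inl hy)).elim
  · exact (key h.symm htV ht.2 (Or.inr hx) (Or.inr hy)).elim
  · exact Or.inl ⟨hx, hy⟩
  · exact (key h hsU hs.2 (Or.inr hx) (Or.inl hy)).elim
  · exact Or.inr ⟨hx, hy⟩
  · exact (key h hsU hs.2 (Or.inr hx) (Or.inr hy)).elim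

/-- There is a continuous function to the unit interval that is injective on the closure of the
separators of `x` and `y`, and takes the values `0` and `1` there only at `x` and `y`. -/
lemma exists_arc_function (hDc : D.Countable)
    (hD : ∀ x y : X, x ≠ y → ∃ p ∈ D, Separates p x y) (hxy : x ≠ y) :
    ∃ f : X → ℝ, Continuous f ∧ (∀ z, f z ∈ Icc (0 : ℝ) 1) ∧
      InjOn f (closure (separators D x y)) ∧
      (∀ z ∈ closure (separators D x y), f z = 0 → z = x) ∧
      (∀ z ∈ closure (separators D x y), f z = 1 → z = y) ∧
      ∀ a b : ℝ, 0 ≤ a → a < b → b ≤ 1 → ∃ z ∈ separators D x y, a < f z ∧ f z < b := by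
  obtain ⟨φ, hφ, hlt, hdense⟩ := exists_separators_parametrization hDc hD hxy
  set S := separators D x y with hS
  -- The supremum of the labels of the separators that come before `z`; if there are none, `sSup ∅ =
  -- 0` is the right value.
  let f : X → ℝ := fun z => sSup (φ '' {p | p ∈ S ∧ Separates p x z})
  have hbdd : ∀ z, BddAbove (φ '' {p | p ∈ S ∧ Separates p x z}) := fun z =>
    ⟨1, by rintro _ ⟨p, hp, rfl⟩; exact (hφ p hp.1).2.le⟩
  have hle : ∀ p ∈ S, ∀ z, Separates p x z → φ p ≤ f z := fun p hp z hz =>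
    le_csSup (hbdd z) ⟨p, ⟨hp, hz⟩, rfl⟩
  have hge : ∀ p ∈ S, ∀ z, ¬ Separates p x z → f z ≤ φ p := by
    intro p hp z hz
    refine Real.sSup_le ?_ (hφ p hp).1.le
    rintro _ ⟨r, ⟨hr, hrz⟩, rfl⟩
    by_contra hcon
    push Not at hcon
    exact hz (((hlt p hp r hr).2 hcon).trans hrz)
  have hf01 : ∀ z, f z ∈ Icc (0 : ℝ) 1 := by
    intro z
    refine ⟨Real.sSup_nonneg ?_, Real.sSup_le ?_ zero_le_one⟩
    · rintro _ ⟨p, hp, rfl⟩; exact (hφ p hp.1).1.le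
    · rintro _ ⟨p, hp, rfl⟩; exact (hφ p hp.1).2.le
  have hfS : ∀ p ∈ S, f p = φ p := by
    intro p hp
    refine le_antisymm (hge p hp p fun h => h.ne_right rfl) ?_
    by_contra hcon
    push Not at hcon
    obtain ⟨q, hq, hq1, hq2⟩ := hdense _ _ (hf01 p).1 hcon (hφ p hp).2.le
    exact absurd (hle q hq p ((hlt q hq p hp).2 hq2)) (not_le.2 hq1)
  -- The point `r` found between `p` and `q` is itself a separator of `x` and `y`: beyond `r` there
  -- is one, either `q` or a separator close to `q`.
  have hbetween : ∀ {p q : X}, p ∈ S → ∀ {U V : Set X}, IsSplit p U V → x ∈ U → q ∈ V →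
      (Separates q x y ∨ q ∈ closure S) → ∃ r ∈ S, r ∈ V ∧ Separates r x q := by
    intro p q hp U V h hx hq hqy
    obtain ⟨r, hrD, hrV, hrq⟩ := h.exists_between hD hx hq
    refine ⟨r, ⟨hrD, ?_⟩, hrV, hrq⟩
    rcases hqy with hqy | hqy
    · exact hrq.trans hqy
    · obtain ⟨U', V', h', hx', hq'⟩ := hrq
      obtain ⟨s, hsV, hs⟩ := mem_closure_iff.1 hqy V' h'.2.1 hq'
      exact Separates.trans ⟨U', V', h', hx', hsV⟩ hs.2
  -- Strictness needs two separators `t` before `r` between `p` and `w`: the value at `z` is at most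
  -- the label of `t`, that at `w` at least the label of `r`.
  have hstrict : ∀ {p z w : X} {U V : Set X}, p ∈ D → IsSplit p U V → z ∈ closure S →
      w ∈ closure S → x ∈ U → y ∈ V → z ∈ U → w ∈ V → f z < f w := by
    intro p z w U V hpD h hz hw hx hy hzU hwV
    have hp : p ∈ S := ⟨hpD, U, V, h, hx, hy⟩
    obtain ⟨r, hr, hrV, hrw⟩ := hbetween hp h hx hwV (Or.inr hw)
    obtain ⟨t, ht, htV, htr⟩ := hbetween hp h hx hrV (Or.inl hr.2)
    calc f z ≤ φ t := hge t ht z (h.not_separates (h.notMem_insert htV) (Or.inr hx) (Or.inr hzU))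
      _ < φ r := (hlt t ht r hr).1 htr
      _ ≤ f w := hle r hr w hrw
  refine ⟨f, ?_, hf01, ?_, ?_, ?_, ?_⟩
  · rw [continuous_iff_continuousAt]
    intro z
    refine tendsto_order.2 ⟨fun c hc => ?_, fun c hc => ?_⟩
    · rcases lt_or_ge c 0 with h0 | h0
      · exact Eventually.of_forall fun w => h0.trans_le (hf01 w).1
      · obtain ⟨p, hp, hp1, hp2⟩ := hdense c (f z) h0 hc (hf01 z).2
        have hpz : Separates p x z := by
          by_contra h
          exact absurd (hge p hp z h) (not_le.2 hp2)
        obtain ⟨U, V, h, hx, hz⟩ := hpz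
        filter_upwards [h.2.1.mem_nhds hz] with w hw
        exact hp1.trans_le (hle p hp w ⟨U, V, h, hx, hw⟩)
    · rcases lt_or_ge 1 c with h1 | h1
      · exact Eventually.of_forall fun w => (hf01 w).2.trans_lt h1
      -- Three labels between `f z` and `c`: `p` does not precede `z`, so `z` lies on the open near
      -- side of `q`, and on that whole side `f` is at most the label of `r`.
      · obtain ⟨p, hp, hp1, hp2⟩ := hdense (f z) c (hf01 z).1 hc h1
        obtain ⟨q, hq, hq1, hq2⟩ := hdense (φ p) c (hφ p hp).1.le hp2 h1
        obtain ⟨r, hr, hr1, hr2⟩ := hdense (φ q) c (hφ q hq).1.le hq2 h1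
        have hnp : ¬ Separates p x z := fun h => absurd (hle p hp z h) (not_le.2 hp1)
        have hpq := (hlt p hp q hq).2 hq1
        obtain ⟨U, V, h, hx, hrV⟩ := (hlt q hq r hr).2 hr1
        have hzU : z ∈ U := by
          by_contra hzU
          by_cases hzq : z = q
          · exact hnp (hzq ▸ hpq)
          · exact hnp (hpq.trans ⟨U, V, h, hx, (h.mem_or hzq).resolve_left hzU⟩)
        filter_upwards [h.1.mem_nhds hzU] with w hw
        exact (hge r hr w (h.not_separates (h.notMem_insert hrV) (Or.inr hx)
          (Or.inr hw))).trans_lt hr2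
  · intro z hz w hw hzw
    by_contra hne
    obtain ⟨p, hpD, U, V, h, hzU, hwV⟩ := hD z w hne
    rcases h.separates_of_mem_closure hz hw hzU hwV with ⟨hx, hy⟩ | ⟨hx, hy⟩
    · exact (hstrict hpD h hz hw hx hy hzU hwV).ne hzw
    · exact (hstrict hpD h.symm hw hz hx hy hwV hzU).ne hzw.symm
  · intro z hz h0
    by_contra hne
    obtain ⟨p, hpD, U, V, h, hxU, hzV⟩ := hD x z (Ne.symm hne)
    obtain ⟨s, hsV, hs⟩ := mem_closure_iff.1 hz V h.2.1 hzV
    have hp : p ∈ S := ⟨hpD, Separates.trans ⟨U, V, h, hxU, hsV⟩ hs.2⟩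
    have := hle p hp z ⟨U, V, h, hxU, hzV⟩
    linarith [(hφ p hp).1]
  · intro z hz h1
    by_contra hne
    obtain ⟨p, hpD, U, V, h, hzU, hyV⟩ := hD z y hne
    obtain ⟨s, hsU, hs⟩ := mem_closure_iff.1 hz U h.1 hzU
    have hxU : x ∈ U := by
      by_contra hxU
      refine h.symm.not_separates (h.symm.notMem_insert hsU) ?_ (Or.inr hyV) hs.2
      by_cases hxp : x = p
      · exact Or.inl hxp
      · exact Or.inr ((h.mem_or hxp).resolve_left hxU)
    obtain ⟨r, hrD, hrV, hry⟩ := h.exists_between hD hxU hyV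
    have hr : r ∈ S := ⟨hrD, hry⟩
    have := hge r hr z (h.not_separates (h.notMem_insert hrV) (Or.inr hxU) (Or.inr hzU))
    linarith [(hφ r hr).2]
  · intro a b ha hab hb
    obtain ⟨p, hp, h⟩ := hdense a b ha hab hb
    exact ⟨p, hp, by rwa [hfS p hp]⟩

/-- In a compact connected Hausdorff space, any two points of which are separated by a point of a
fixed countable set, any two points are the end points of an arc. -/
theorem exists_injective_path [CompactSpace X] [T2Space X] (hDc : D.Countable)
    (hD : ∀ x y : X, x ≠ y → ∃ p ∈ D, Separates p x y) (hxy : x ≠ y) :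
    ∃ γ : Path x y, Function.Injective γ := by
  obtain ⟨f, hf, hf01, hinj, hf0, hf1, hdense⟩ := exists_arc_function hDc hD hxy
  set C := closure (separators D x y) with hC
  have hcomp : IsCompact C := isClosed_closure.isCompact
  -- The image is compact, and contains a dense subset of `(0, 1)` by `hdense`.
  have himg : f '' C = Icc 0 1 := by
    apply Subset.antisymm
    · rintro _ ⟨z, -, rfl⟩
      exact hf01 z
    · rw [← closure_Ioo zero_ne_one]
      refine closure_minimal ?_ (hcomp.image hf).isClosed
      have hsub : closure (f '' separators D x y) ⊆ f '' C :=
        closure_minimal (image_mono subset_closure) (hcomp.image hf).isClosed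
      refine fun t ht => hsub ?_
      rw [mem_closure_iff_nhds_basis (nhds_basis_Ioo t)]
      rintro ⟨a, b⟩ ⟨hat, htb⟩
      obtain ⟨z, hz, h1, h2⟩ := hdense (max a 0) t (le_max_right _ _) (max_lt hat ht.1) ht.2.le
      exact ⟨f z, ⟨z, hz, rfl⟩, (le_max_left _ _).trans_lt h1, h2.trans htb⟩
  have hbij : BijOn f C (Icc 0 1) := ⟨fun z _ => hf01 z, hinj, himg.ge⟩
  have : CompactSpace C := isCompact_iff_compactSpace.1 hcomp
  let e := Continuous.homeoOfEquivCompactToT2 (f := hbij.equiv f)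
    (by exact Continuous.subtype_mk (hf.comp continuous_subtype_val) _)
  have hev : ∀ z : C, ((e z : Icc (0 : ℝ) 1) : ℝ) = f z := fun z => rfl
  have h0 : (e.symm 0 : X) = x := hf0 _ (e.symm 0).2 (by rw [← hev]; simp)
  have h1 : (e.symm 1 : X) = y := hf1 _ (e.symm 1).2 (by rw [← hev]; simp)
  exact ⟨⟨⟨fun t => (e.symm t : X), by fun_prop⟩, h0, h1⟩,
    Subtype.val_injective.comp e.symm.injective⟩

end Dendrite

/-- An arc is the closure of the points that separate its end points. -/
theorem range_eq_closure_separators {X : Type*} [TopologicalSpace X] [T2Space X]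
    {D : Set X} {x y : X}
    (hD : ∀ x y : X, x ≠ y → ∃ p ∈ D, Separates p x y) (γ : Path x y)
    (hγ : Function.Injective γ) : range γ = closure (separators D x y) := by
  apply Subset.antisymm
  · rintro _ ⟨t, rfl⟩
    rw [mem_closure_iff]
    intro W hW htW
    -- A short subarc around the point stays in `W`. A point that separates its ends lies on it, and
    -- by injectivity the two remaining parts of the arc avoid that point, so it also separates `x`
    -- from `y`.
    obtain ⟨a, b, hab, hW'⟩ : ∃ a b : unitInterval, a < b ∧ γ '' Icc a b ⊆ W := by
      have hn : γ ⁻¹' W ∈ 𝓝 t := (hW.preimage γ.continuous).mem_nhds htW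
      obtain ⟨ε, hε, hball⟩ := Metric.mem_nhds_iff.1 hn
      by_cases ht : (t : ℝ) < 1
      · have hm : (t : ℝ) < min 1 (t + ε / 2) := lt_min ht (by linarith)
        refine ⟨t, ⟨min 1 (t + ε / 2), t.2.1.trans hm.le, min_le_left _ _⟩, hm, ?_⟩
        rintro _ ⟨s, ⟨h1, h2⟩, rfl⟩
        apply hball
        have h1 : (t : ℝ) ≤ s := h1
        have h2 : (s : ℝ) ≤ min 1 (t + ε / 2) := h2
        rw [Metric.mem_ball, Subtype.dist_eq, Real.dist_eq, abs_of_nonneg (by linarith)]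
        linarith [min_le_right 1 ((t : ℝ) + ε / 2)]
      · have ht1 : (t : ℝ) = 1 := le_antisymm t.2.2 (not_lt.1 ht)
        have hm : max 0 ((t : ℝ) - ε / 2) < t := max_lt (by linarith) (by linarith)
        refine ⟨⟨max 0 (t - ε / 2), le_max_left _ _, hm.le.trans t.2.2⟩, t, hm, ?_⟩
        rintro _ ⟨s, ⟨h1, h2⟩, rfl⟩
        apply hball
        have h1 : max 0 ((t : ℝ) - ε / 2) ≤ s := h1
        have h2 : (s : ℝ) ≤ t := h2
        rw [Metric.mem_ball, dist_comm, Subtype.dist_eq, Real.dist_eq, abs_of_nonneg (by linarith)]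
        linarith [le_max_right 0 ((t : ℝ) - ε / 2)]
    obtain ⟨p, hpD, U, V, h, haU, hbV⟩ := hD (γ a) (γ b) (fun e => hab.ne (hγ e))
    have hpre : ∀ s t : unitInterval, IsPreconnected (γ '' Icc s t) := fun s t =>
      isPreconnected_Icc.image _ γ.continuous.continuousOn
    obtain ⟨s, ⟨has, hsb⟩, hs⟩ := h.mem_of_isPreconnected (hpre a b)
      ⟨a, ⟨le_rfl, hab.le⟩, rfl⟩ haU
      ⟨b, ⟨hab.le, le_rfl⟩, rfl⟩ hbV
    have hsa : a < s := lt_of_le_of_ne has (by rintro rfl; exact h.notMem_left (hs ▸ haU))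
    have hsb' : s < b := lt_of_le_of_ne hsb (by rintro rfl; exact h.notMem_right (hs ▸ hbV))
    refine ⟨p, hW' ⟨s, ⟨has, hsb⟩, hs⟩, hpD, U, V, h, ?_, ?_⟩
    · have hne : x ≠ p := fun e =>
        (unitInterval.nonneg'.trans_lt hsa).ne (hγ (γ.source.trans (e.trans hs.symm)))
      refine (h.mem_or hne).resolve_right fun hxV => ?_
      obtain ⟨r, ⟨-, hr⟩, hrp⟩ := h.mem_of_isPreconnected (hpre 0 a)
        ⟨a, ⟨unitInterval.nonneg a, le_rfl⟩, rfl⟩ haU ⟨0, ⟨le_rfl, unitInterval.nonneg a⟩, γ.source⟩ hxV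
      exact (hr.trans_lt hsa).ne (hγ (hrp.trans hs.symm))
    · have hne : y ≠ p := fun e =>
        (hsb'.trans_le (unitInterval.le_one b)).ne' (hγ (γ.target.trans (e.trans hs.symm)))
      refine (h.mem_or hne).resolve_left fun hyU => ?_
      obtain ⟨r, ⟨hr, -⟩, hrp⟩ := h.mem_of_isPreconnected (hpre b 1)
        ⟨1, ⟨unitInterval.le_one b, le_rfl⟩, γ.target⟩ hyU ⟨b, ⟨le_rfl, unitInterval.le_one b⟩, rfl⟩ hbV
      exact (hsb'.trans_le hr).ne' (hγ (hrp.trans hs.symm))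
  · refine closure_minimal ?_ (isCompact_range γ.continuous).isClosed
    rintro p ⟨-, h⟩
    exact h.mem_of_isPreconnected (isPreconnected_range γ.continuous) ⟨0, γ.source⟩ ⟨1, γ.target⟩

/-! ### Trees of squares and substitution of cross patterns -/

section Grid

/-- The four unit vectors of the grid. -/
def IsDir (d : ℤ × ℤ) : Prop := d = (1, 0) ∨ d = (-1, 0) ∨ d = (0, 1) ∨ d = (0, -1)

lemma IsDir.neg {d : ℤ × ℤ} (h : IsDir d) : IsDir (-d) := by
  rcases h with rfl | rfl | rfl | rfl <;> simp [IsDir]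

lemma IsDir.sub_comm {a b : ℤ × ℤ} (h : IsDir (b - a)) : IsDir (a - b) := by
  simpa using h.neg

lemma IsDir.ne_neg {d : ℤ × ℤ} (h : IsDir d) : d ≠ -d := by
  rcases h with rfl | rfl | rfl | rfl <;> simp

/-- `C` contains `b` but not `a`, and `(a, b)` is the only pair of adjacent squares of `V` that
leads from the outside of `C` to the inside. -/
structure IsCut (V : Set (ℤ × ℤ)) (a b : ℤ × ℤ) (C : Set (ℤ × ℤ)) : Prop where
  notMem : a ∉ C
  mem : b ∈ C
  eq_of_cross : ∀ x ∈ V, ∀ y ∈ V, IsDir (y - x) → x ∉ C → y ∈ C → x = a ∧ y = b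

lemma IsCut.compl {V : Set (ℤ × ℤ)} {a b : ℤ × ℤ} {C : Set (ℤ × ℤ)} (h : IsCut V a b C) :
    IsCut V b a Cᶜ where
  notMem := fun hb => hb h.mem
  mem := h.notMem
  eq_of_cross := fun x hx y hy hd hxC hyC =>
    (h.eq_of_cross y hy x hx hd.sub_comm hyC (not_not.1 hxC)).symm

/-- Every two squares of `V` are linked by a chain of adjacent squares of `V`. -/
def GridConnected (V : Set (ℤ × ℤ)) : Prop :=
  ∀ S : Set (ℤ × ℤ), (∀ x ∈ V, ∀ y ∈ V, IsDir (y - x) → x ∈ S → y ∈ S) →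
    ∀ x ∈ V, x ∈ S → ∀ y ∈ V, y ∈ S

/-- Every pair of adjacent squares of `V` is a bridge of the adjacency graph. -/
def GridAcyclic (V : Set (ℤ × ℤ)) : Prop :=
  ∀ a ∈ V, ∀ b ∈ V, IsDir (b - a) → ∃ C, IsCut V a b C

/-- The middle square on the side `d` of the grid of width `2 h + 1`. -/
def exitSquare (h : ℤ) (d : ℤ × ℤ) : ℤ × ℤ := (h + h * d.1, h + h * d.2)

/-- A labyrinth pattern of width `2 h + 1`: it is a tree, and meets the border of the grid exactly
in the middle squares of the four sides; every edge cuts off exactly one of these from the others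
on one of its two sides. -/
structure IsCross (h : ℤ) (A : Set (ℤ × ℤ)) : Prop where
  pos : 0 < h
  bounds : ∀ w ∈ A, 0 ≤ w.1 ∧ w.1 ≤ 2 * h ∧ 0 ≤ w.2 ∧ w.2 ≤ 2 * h
  border : ∀ w ∈ A, (w.1 = 0 ∨ w.1 = 2 * h → w.2 = h) ∧ (w.2 = 0 ∨ w.2 = 2 * h → w.1 = h)
  exit_mem : ∀ d, IsDir d → exitSquare h d ∈ A
  connected : GridConnected A
  cut : ∀ a ∈ A, ∀ b ∈ A, IsDir (b - a) → ∃ C d, IsDir d ∧ (IsCut A a b C ∨ IsCut A b a C) ∧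
    ∀ e, IsDir e → (exitSquare h e ∈ C ↔ e = d)

/-- The position of the square `w` of the grid of width `2 h + 1`, scaled into the square `q`. -/
def subSquare (h : ℤ) (q w : ℤ × ℤ) : ℤ × ℤ :=
  ((2 * h + 1) * q.1 + w.1, (2 * h + 1) * q.2 + w.2)

/-- The squares of the pattern `A`, scaled into the squares of `V`. -/
def substitution (h : ℤ) (V A : Set (ℤ × ℤ)) : Set (ℤ × ℤ) :=
  {c | ∃ q ∈ V, ∃ w ∈ A, c = subSquare h q w}

lemma eq_of_mul_add_eq {h q w q' w' : ℤ} (h0 : 0 ≤ w) (h1 : w ≤ 2 * h) (h0' : 0 ≤ w')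
    (h1' : w' ≤ 2 * h) (e : (2 * h + 1) * q + w = (2 * h + 1) * q' + w') : q = q' ∧ w = w' := by
  have hq : q = q' := by
    rcases lt_trichotomy q q' with hlt | heq | hlt
    · nlinarith
    · exact heq
    · nlinarith
  subst hq
  exact ⟨rfl, by linarith⟩

lemma eq_or_of_mul_add_eq {h q w q' w' : ℤ} (h0 : 0 ≤ w) (h1 : w ≤ 2 * h) (h0' : 0 ≤ w')
    (h1' : w' ≤ 2 * h) (e : (2 * h + 1) * q + w + 1 = (2 * h + 1) * q' + w') :
    (q' = q ∧ w' = w + 1) ∨ (q' = q + 1 ∧ w = 2 * h ∧ w' = 0) := by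
  rcases eq_or_lt_of_le h1 with hw | hw
  · right
    obtain ⟨h2, h3⟩ := eq_of_mul_add_eq (h := h) (q := q + 1) (w := 0) le_rfl (by linarith) h0' h1'
      (by linarith)
    exact ⟨h2.symm, hw, h3.symm⟩
  · left
    obtain ⟨h2, h3⟩ := eq_of_mul_add_eq (h := h) (q := q) (w := w + 1) (by linarith) (by linarith)
      h0' h1' (by linarith)
    exact ⟨h2.symm, h3.symm⟩

variable {h : ℤ} {A V : Set (ℤ × ℤ)}

namespace IsCross

lemma subSquare_inj (hA : IsCross h A) {q w q' w' : ℤ × ℤ} (hw : w ∈ A) (hw' : w' ∈ A)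
    (e : subSquare h q w = subSquare h q' w') : q = q' ∧ w = w' := by
  obtain ⟨b1, b2, b3, b4⟩ := hA.bounds w hw
  obtain ⟨c1, c2, c3, c4⟩ := hA.bounds w' hw'
  simp only [subSquare, Prod.mk.injEq] at e
  obtain ⟨h1, h2⟩ := eq_of_mul_add_eq b1 b2 c1 c2 e.1
  obtain ⟨h3, h4⟩ := eq_of_mul_add_eq b3 b4 c3 c4 e.2
  exact ⟨Prod.ext h1 h3, Prod.ext h2 h4⟩

/-- Adjacent squares of a substitution lie in the same square, or are facing exits of adjacent
squares. -/
lemma isDir_subSquare (hA : IsCross h A) {q w q' w' : ℤ × ℤ} (hw : w ∈ A) (hw' : w' ∈ A)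
    (e : IsDir (subSquare h q' w' - subSquare h q w)) :
    (q' = q ∧ IsDir (w' - w)) ∨
      ∃ d, IsDir d ∧ q' = q + d ∧ w = exitSquare h d ∧ w' = exitSquare h (-d) := by
  obtain ⟨b1, b2, b3, b4⟩ := hA.bounds w hw
  obtain ⟨c1, c2, c3, c4⟩ := hA.bounds w' hw'
  obtain ⟨B1, B2⟩ := hA.border w hw
  obtain ⟨q1, q2⟩ := q
  obtain ⟨w1, w2⟩ := w
  obtain ⟨q1', q2'⟩ := q'
  obtain ⟨w1', w2'⟩ := w'
  simp only [IsDir, subSquare, Prod.mk_sub_mk, Prod.mk.injEq] at *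
  -- In the direction of the step the remainder either changes by one or carries over; a carry puts
  -- `w` on the border, where `border` makes it an exit.
  rcases e with ⟨e1, e2⟩ | ⟨e1, e2⟩ | ⟨e1, e2⟩ | ⟨e1, e2⟩
  · obtain ⟨rfl, rfl⟩ := eq_of_mul_add_eq c3 c4 b3 b4 (sub_eq_zero.1 e2)
    rcases eq_or_of_mul_add_eq b1 b2 c1 c2 (q := q1) (q' := q1') (by linarith) with
      ⟨rfl, rfl⟩ | ⟨rfl, rfl, rfl⟩
    · left; simp
    · right
      exact ⟨(1, 0), by simp, by simp, by simp [exitSquare, B1]; ring, by simp [exitSquare, B1]⟩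
  · obtain ⟨rfl, rfl⟩ := eq_of_mul_add_eq c3 c4 b3 b4 (sub_eq_zero.1 e2)
    rcases eq_or_of_mul_add_eq c1 c2 b1 b2 (q := q1') (q' := q1) (by linarith) with
      ⟨rfl, rfl⟩ | ⟨rfl, rfl, rfl⟩
    · left; simp
    · right
      exact ⟨(-1, 0), by simp, by simp, by simp [exitSquare, B1], by simp [exitSquare, B1]; ring⟩
  · obtain ⟨rfl, rfl⟩ := eq_of_mul_add_eq c1 c2 b1 b2 (sub_eq_zero.1 e1)
    rcases eq_or_of_mul_add_eq b3 b4 c3 c4 (q := q2) (q' := q2') (by linarith) with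
      ⟨rfl, rfl⟩ | ⟨rfl, rfl, rfl⟩
    · left; simp
    · right
      exact ⟨(0, 1), by simp, by simp, by simp [exitSquare, B2]; ring, by simp [exitSquare, B2]⟩
  · obtain ⟨rfl, rfl⟩ := eq_of_mul_add_eq c1 c2 b1 b2 (sub_eq_zero.1 e1)
    rcases eq_or_of_mul_add_eq c3 c4 b3 b4 (q := q2') (q' := q2) (by linarith) with
      ⟨rfl, rfl⟩ | ⟨rfl, rfl, rfl⟩
    · left; simp
    · right
      exact ⟨(0, -1), by simp, by simp, by simp [exitSquare, B2], by simp [exitSquare, B2]; ring⟩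

/-- Each copy of `A` is connected, and copies in adjacent squares are linked through their facing
exits. -/
lemma gridConnected_substitution (hA : IsCross h A) (hV : GridConnected V) :
    GridConnected (substitution h V A) := by
  intro S hS x hx hxS y hy
  have hin : ∀ q ∈ V, ∀ w ∈ A, subSquare h q w ∈ S → ∀ w' ∈ A, subSquare h q w' ∈ S := by
    intro q hq w hw hwS w' hw'
    refine hA.connected {w | subSquare h q w ∈ S} ?_ w hw hwS w' hw'
    intro u hu v hv huv huS
    refine hS _ ⟨q, hq, u, hu, rfl⟩ _ ⟨q, hq, v, hv, rfl⟩ ?_ huS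
    convert huv using 1
    simp [subSquare, Prod.ext_iff]
  obtain ⟨q, hq, w, hw, rfl⟩ := hx
  obtain ⟨q', hq', w', hw', rfl⟩ := hy
  refine hV {q | ∀ w ∈ A, subSquare h q w ∈ S} ?_ q hq (hin q hq w hw hxS) q' hq' w' hw'
  intro q hq r hr hd hqS
  refine hin r hr _ (hA.exit_mem _ hd.neg) ?_
  refine hS _ ⟨q, hq, _, hA.exit_mem _ hd, rfl⟩ _ ⟨r, hr, _, hA.exit_mem _ hd.neg, rfl⟩ ?_
    (hqS _ (hA.exit_mem _ hd))
  obtain ⟨d, rfl⟩ : ∃ d, r = q + d := ⟨r - q, by simp⟩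
  simp only [add_sub_cancel_left] at hd ⊢
  convert hd using 1
  rcases hd with rfl | rfl | rfl | rfl <;>
    simp only [subSquare, exitSquare, Prod.ext_iff, Prod.fst_sub, Prod.snd_sub, Prod.fst_add,
      Prod.snd_add, Prod.neg_mk] <;> constructor <;> ring

/-- A cut of the pattern that has exactly one exit on its inner side extends to a cut of the
substitution. -/
lemma exists_isCut_substitution (hA : IsCross h A) (hV : GridAcyclic V) {q w w' d : ℤ × ℤ}
    {O : Set (ℤ × ℤ)} (hq : q ∈ V) (hw : w ∈ A) (hw' : w' ∈ A) (hO : IsCut A w w' O) (hd : IsDir d)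
    (hOd : ∀ e, IsDir e → (exitSquare h e ∈ O ↔ e = d)) :
    ∃ C, IsCut (substitution h V A) (subSquare h q w) (subSquare h q w') C ∧
      ∀ u ∈ A, (subSquare h q u ∈ C ↔ u ∈ O) := by
  -- The part `O` of the copy in `q` can be left for other copies only through the exit at `d`. So
  -- the cut consists of `O` and of all copies beyond the edge from `q` to `q + d`; without a white
  -- neighbour there, nothing lies beyond and `B` is empty.
  obtain ⟨B, hqB, hqdB, hB⟩ : ∃ B : Set (ℤ × ℤ), q ∉ B ∧ (q + d ∈ V → q + d ∈ B) ∧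
      ∀ x ∈ V, ∀ y ∈ V, IsDir (y - x) → x ∉ B → y ∈ B → x = q ∧ y = q + d := by
    by_cases hqd : q + d ∈ V
    · obtain ⟨B, hB⟩ := hV q hq (q + d) hqd (by simpa using hd)
      exact ⟨B, hB.notMem, fun _ => hB.mem, hB.eq_of_cross⟩
    · exact ⟨∅, by simp, fun h => absurd h hqd, by simp⟩
  let C : Set (ℤ × ℤ) := {c | ∃ r, ∃ u ∈ A, c = subSquare h r u ∧ ((r = q ∧ u ∈ O) ∨ r ∈ B)}
  have hC : ∀ r, ∀ u ∈ A, (subSquare h r u ∈ C ↔ ((r = q ∧ u ∈ O) ∨ r ∈ B)) := by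
    intro r u hu
    constructor
    · rintro ⟨r', u', hu', e, h'⟩
      obtain ⟨rfl, rfl⟩ := hA.subSquare_inj hu hu' e
      exact h'
    · intro h'
      exact ⟨r, u, hu, rfl, h'⟩
  refine ⟨C, ⟨?_, ?_, ?_⟩, ?_⟩
  · rw [hC q w hw]
    simp [hqB, hO.notMem]
  · rw [hC q w' hw']
    exact Or.inl ⟨rfl, hO.mem⟩
  · rintro _ ⟨r, hr, u, hu, rfl⟩ _ ⟨s, hs, v, hv, rfl⟩ hdir hx hy
    rw [hC r u hu] at hx
    rw [hC s v hv] at hy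
    push Not at hx
    rcases hA.isDir_subSquare hu hv hdir with ⟨rfl, huv⟩ | ⟨e, he, rfl, rfl, rfl⟩
    · rcases hy with ⟨rfl, hvO⟩ | hy
      · obtain ⟨rfl, rfl⟩ := hO.eq_of_cross u hu v hv huv (hx.1 rfl) hvO
        exact ⟨rfl, rfl⟩
      · exact absurd hy hx.2
    · rcases hy with ⟨hrq, hvO⟩ | hy
      · have hed : -e = d := (hOd _ he.neg).1 hvO
        have hrd : r = q + d := by rw [← hrq, ← hed]; simp
        exact absurd (hrd ▸ hqdB (hrd ▸ hr)) hx.2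
      · obtain ⟨rfl, h2⟩ := hB r hr _ hs (by simpa using he) hx.2 hy
        have hed : e = d := add_left_cancel h2
        exact absurd ((hOd e he).2 hed) (hx.1 rfl)
  · intro u hu
    rw [hC q u hu]
    simp [hqB]

/-- An edge inside a copy extends its cut of the pattern. An edge between two copies inherits the
cut of `V`, and stays the only crossing because adjacent copies touch in a single pair of exits. -/
lemma gridAcyclic_substitution (hA : IsCross h A) (hV : GridAcyclic V) :
    GridAcyclic (substitution h V A) := by
  rintro _ ⟨q, hq, w, hw, rfl⟩ _ ⟨q', hq', w', hw', rfl⟩ hdir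
  rcases hA.isDir_subSquare hw hw' hdir with ⟨rfl, hww'⟩ | ⟨d, hd, rfl, rfl, rfl⟩
  · obtain ⟨O, d, hd, hO | hO, hOd⟩ := hA.cut w hw w' hw' hww'
    · obtain ⟨C, hC, -⟩ := hA.exists_isCut_substitution hV hq hw hw' hO hd hOd
      exact ⟨C, hC⟩
    · obtain ⟨C, hC, -⟩ := hA.exists_isCut_substitution hV hq hw' hw hO hd hOd
      exact ⟨Cᶜ, hC.compl⟩
  · obtain ⟨B, hB⟩ := hV q hq (q + d) hq' (by simpa using hd)
    let C : Set (ℤ × ℤ) := {c | ∃ r, ∃ u ∈ A, c = subSquare h r u ∧ r ∈ B}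
    have hC : ∀ r, ∀ u ∈ A, (subSquare h r u ∈ C ↔ r ∈ B) := by
      intro r u hu
      constructor
      · rintro ⟨r', u', hu', e, h'⟩
        obtain ⟨rfl, rfl⟩ := hA.subSquare_inj hu hu' e
        exact h'
      · intro h'
        exact ⟨r, u, hu, rfl, h'⟩
    refine ⟨C, (hC _ _ hw).not.2 hB.notMem, (hC _ _ hw').2 hB.mem, ?_⟩
    rintro _ ⟨r, hr, u, hu, rfl⟩ _ ⟨s, hs, v, hv, rfl⟩ hdir' hx hy
    rw [hC r u hu] at hx
    rw [hC s v hv] at hy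
    rcases hA.isDir_subSquare hu hv hdir' with ⟨rfl, -⟩ | ⟨e, he, rfl, rfl, rfl⟩
    · exact absurd hy hx
    · obtain ⟨rfl, h2⟩ := hB.eq_of_cross r hr _ hs (by simpa using he) hx hy
      obtain rfl : e = d := add_left_cancel h2
      exact ⟨rfl, rfl⟩

end IsCross

/-- In a connected `V` with the square `q`, any other square lies beyond one of the neighbours
of `q`. -/
lemma GridConnected.exists_dir (hV : GridConnected V) (hc : GridAcyclic V) {q r : ℤ × ℤ}
    (hq : q ∈ V) (hr : r ∈ V) (hqr : r ≠ q) :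
    ∃ d C, IsDir d ∧ q + d ∈ V ∧ IsCut V q (q + d) C ∧ r ∈ C := by
  -- This set is closed under adjacency, because the far side of a cut at `q` can be left only
  -- through `q`.
  have key := hV {s | s = q ∨ ∃ d C, IsDir d ∧ q + d ∈ V ∧ IsCut V q (q + d) C ∧ s ∈ C} ?_ q hq
    (Or.inl rfl) r hr
  · exact key.resolve_left hqr
  · rintro x hx y hy hxy (rfl | ⟨d, C, hd, hdV, hC, hxC⟩)
    · obtain ⟨d, rfl⟩ : ∃ d, y = x + d := ⟨y - x, by simp⟩
      obtain ⟨C, hC⟩ := hc x hx _ hy hxy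
      exact Or.inr ⟨d, C, by simpa using hxy, hy, hC, hC.mem⟩
    · by_cases hyC : y ∈ C
      · exact Or.inr ⟨d, C, hd, hdV, hC, hyC⟩
      · exact Or.inl (hC.eq_of_cross y hy x hx hxy.sub_comm hyC hxC).1

/-- The two sides of a bridge are disjoint. -/
lemma GridConnected.disjoint_of_isCut (hV : GridConnected V) {a b r : ℤ × ℤ} (ha : a ∈ V)
    (hr : r ∈ V) {C C' : Set (ℤ × ℤ)} (hC : IsCut V a b C) (hC' : IsCut V b a C')
    (hrC : r ∈ C) : r ∉ C' := by
  intro hrC'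
  -- The intersection is closed under adjacency: `C` is left only from `b`, which is not in `C'`,
  -- and `C'` only from `a`, which is not in `C`. It would thus contain all of `V`, and `a` in
  -- particular.
  refine hC.notMem (hV (C ∩ C') ?_ r hr ⟨hrC, hrC'⟩ a ha).1
  rintro x hx y hy hxy ⟨hxC, hxC'⟩
  constructor
  · by_contra hyC
    exact hC'.notMem ((hC.eq_of_cross y hy x hx hxy.sub_comm hyC hxC).2 ▸ hxC')
  · by_contra hyC
    exact hC.notMem ((hC'.eq_of_cross y hy x hx hxy.sub_comm hyC hxC').2 ▸ hxC)

end Grid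

/-! ### The snake arm is a path between the diagonals -/

section Snake

variable {k : ℕ}

/-- This bound keeps the run at height `2 j + 2` strictly between the diagonals. -/
lemma abs_snakeTurn_succ_le (k j : ℕ) : |snakeTurn k (j + 1)| ≤ 2 * j + 1 := by
  by_cases h : j + 1 = k + 1
  · rw [snakeTurn, if_pos (Or.inr h), abs_zero]
    positivity
  · rw [snakeTurn, if_neg (by omega), abs_mul, abs_pow, abs_neg, abs_one, one_pow, one_mul, abs_le]
    constructor <;> push_cast <;> omega

lemma abs_snakeTurn_le (k j : ℕ) : |snakeTurn k j| ≤ 2 * j := by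
  cases j with
  | zero => simp [snakeTurn]
  | succ j =>
    have := abs_snakeTurn_succ_le k j
    push_cast
    linarith

lemma snakeTurn_zero (k : ℕ) : snakeTurn k 0 = 0 := by simp [snakeTurn]

lemma snakeTurn_last (k : ℕ) : snakeTurn k (k + 1) = 0 := by simp [snakeTurn]

lemma mem_snakeArm {u v : ℤ} : (u, v) ∈ snakeArm k ↔
    (∃ j : ℕ, j ≤ k + 1 ∧ u = snakeTurn k j ∧ v = 2 * j + 1) ∨
    ∃ j : ℕ, j ≤ k ∧ u ∈ uIcc (snakeTurn k j) (snakeTurn k (j + 1)) ∧ v = 2 * j + 2 := Iff.rfl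

/-- The arm lies in the open upper quadrant between the diagonals, and only its last square is in
the top row. -/
lemma snakeArm_bounds {u v : ℤ} (h : (u, v) ∈ snakeArm k) :
    -v < u ∧ u < v ∧ v ≤ 2 * k + 3 ∧ (v = 2 * k + 3 → u = 0) := by
  rcases mem_snakeArm.1 h with ⟨j, hj, rfl, rfl⟩ | ⟨j, hj, hu, rfl⟩
  · have := abs_le.1 (abs_snakeTurn_le k j)
    refine ⟨by omega, by omega, by omega, fun h => ?_⟩
    obtain rfl : j = k + 1 := by omega
    exact snakeTurn_last k
  · have h1 := abs_le.1 (abs_snakeTurn_le k j)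
    have h2 := abs_le.1 (abs_snakeTurn_succ_le k j)
    rw [mem_uIcc] at hu
    refine ⟨?_, ?_, ?_, ?_⟩ <;> omega

/-- The upper arm together with the central square. -/
def rootedArm (k : ℕ) : Set (ℤ × ℤ) := insert (0, 0) (snakeArm k)

lemma snd_nonneg_of_mem_rootedArm {u v : ℤ} (h : (u, v) ∈ rootedArm k) :
    0 ≤ v ∧ v ≤ 2 * k + 3 := by
  rcases h with h | h
  · simp only [Prod.mk.injEq] at h
    omega
  · have := snakeArm_bounds h
    omega

/-- Between consecutive heights the arm has only one vertical edge. The link at height `2 j + 1`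
carries those starting at heights `2 j` and `2 j + 1`, hence the index `v.toNat / 2`. -/
lemma fst_eq_of_mem_rootedArm_of_mem_succ {u v : ℤ} (h : (u, v) ∈ rootedArm k)
    (h' : (u, v + 1) ∈ rootedArm k) : u = snakeTurn k (v.toNat / 2) := by
  rcases h with h | h
  · simp only [Prod.mk.injEq] at h
    simp [h.1, h.2, snakeTurn_zero]
  rcases h' with h' | h'
  · simp only [Prod.mk.injEq] at h'
    have := snakeArm_bounds h
    omega
  rcases mem_snakeArm.1 h with ⟨j, hj, hu, rfl⟩ | ⟨j, hj, hu, rfl⟩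
  · rw [hu]
    congr 1
    omega
  · rcases mem_snakeArm.1 h' with ⟨i, hi, hu, hv⟩ | ⟨i, hi, hu, hv⟩
    · rw [hu]
      congr 1
      omega
    · omega

lemma mem_rootedArm_of_mem_right {u v : ℤ} (h : (u, v) ∈ rootedArm k)
    (h' : (u + 1, v) ∈ rootedArm k) : ∃ j : ℕ, v = 2 * j + 2 ∧
      u ∈ uIcc (snakeTurn k j) (snakeTurn k (j + 1)) ∧
      u + 1 ∈ uIcc (snakeTurn k j) (snakeTurn k (j + 1)) := by
  have hv : v ≠ 0 := by
    rintro rfl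
    rcases h with h | h
    · simp only [Prod.mk.injEq] at h
      rcases h' with h' | h'
      · simp only [Prod.mk.injEq] at h'
        omega
      · have := snakeArm_bounds h'
        omega
    · have := snakeArm_bounds h
      omega
  have h1 : (u, v) ∈ snakeArm k := h.resolve_left (by simp [hv])
  have h2 : (u + 1, v) ∈ snakeArm k := h'.resolve_left (by simp [hv])
  rcases mem_snakeArm.1 h1 with ⟨j, hj, hu, hv1⟩ | ⟨j, hj, hu, hv1⟩ <;>
    rcases mem_snakeArm.1 h2 with ⟨i, hi, hu', hv2⟩ | ⟨i, hi, hu', hv2⟩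
  · obtain rfl : i = j := by omega
    omega
  · omega
  · omega
  · obtain rfl : i = j := by omega
    exact ⟨i, hv1, hu, hu'⟩

/-- Every edge of the arm cuts it into an inner and an outer part. -/
lemma exists_isCut_rootedArm_of_le {a b : ℤ × ℤ} (ha : a ∈ rootedArm k) (hb : b ∈ rootedArm k)
    (hab : b - a = (1, 0) ∨ b - a = (0, 1)) :
    ∃ O, (IsCut (rootedArm k) a b O ∨ IsCut (rootedArm k) b a O) ∧ (0, 0) ∉ O ∧
      (0, 2 * (k : ℤ) + 3) ∈ O := by
  obtain ⟨u, v⟩ := a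
  rcases hab with hab | hab
  · obtain rfl : b = (u + 1, v) := by
      rw [sub_eq_iff_eq_add] at hab
      rw [hab]; ext <;> simp [add_comm]
    obtain ⟨j, rfl, h1, h2⟩ := mem_rootedArm_of_mem_right ha hb
    rw [mem_uIcc] at h1 h2
    have hv := (snd_nonneg_of_mem_rootedArm ha).2
    have e1 : (2 * (j : ℤ) + 2).toNat / 2 = j + 1 := by omega
    have e2 : (2 * (j : ℤ) + 1).toNat / 2 = j := by omega
    -- The outer part is all that lies higher, together with the part of the run beyond the edge.
    -- The run is entered in column `snakeTurn k j` and left in column `snakeTurn k (j + 1)`, so by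
    -- `e2` and `e1` neither link crosses the cut.
    rcases le_total (snakeTurn k j) (snakeTurn k (j + 1)) with hle | hle
    · refine ⟨{c | 2 * (j : ℤ) + 2 < c.2 ∨ (c.2 = 2 * (j : ℤ) + 2 ∧ u + 1 ≤ c.1)},
        Or.inl ⟨by simp, by simp, ?_⟩, ?_, ?_⟩
      · rintro ⟨x1, x2⟩ hx ⟨y1, y2⟩ hy hd hxO hyO
        simp only [IsDir, Prod.mk_sub_mk, Prod.mk.injEq, mem_ofPred_eq] at *
        rcases hd with hd | hd | hd | hd
        · omega
        · omega
        · obtain rfl : y1 = x1 := by omega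
          obtain rfl : y2 = x2 + 1 := by omega
          have := fst_eq_of_mem_rootedArm_of_mem_succ hx hy
          rcases hyO with hyO | hyO
          · obtain rfl : x2 = 2 * j + 2 := by omega
            rw [e1] at this
            omega
          · obtain rfl : x2 = 2 * j + 1 := by omega
            rw [e2] at this
            omega
        · omega
      · simp only [mem_ofPred_eq]; omega
      · simp only [mem_ofPred_eq]; omega
    · refine ⟨{c | 2 * (j : ℤ) + 2 < c.2 ∨ (c.2 = 2 * (j : ℤ) + 2 ∧ c.1 ≤ u)},
        Or.inr ⟨by simp, by simp, ?_⟩, ?_, ?_⟩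
      · rintro ⟨x1, x2⟩ hx ⟨y1, y2⟩ hy hd hxO hyO
        simp only [IsDir, Prod.mk_sub_mk, Prod.mk.injEq, mem_ofPred_eq] at *
        rcases hd with hd | hd | hd | hd
        · omega
        · omega
        · obtain rfl : y1 = x1 := by omega
          obtain rfl : y2 = x2 + 1 := by omega
          have := fst_eq_of_mem_rootedArm_of_mem_succ hx hy
          rcases hyO with hyO | hyO
          · obtain rfl : x2 = 2 * j + 2 := by omega
            rw [e1] at this
            omega
          · obtain rfl : x2 = 2 * j + 1 := by omega
            rw [e2] at this
            omega
        · omega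
      · simp only [mem_ofPred_eq]; omega
      · simp only [mem_ofPred_eq]; omega
  · obtain rfl : b = (u, v + 1) := by
      rw [sub_eq_iff_eq_add] at hab
      rw [hab]; ext <;> simp [add_comm]
    have h1 := snd_nonneg_of_mem_rootedArm ha
    have h2 := snd_nonneg_of_mem_rootedArm hb
    have hu := fst_eq_of_mem_rootedArm_of_mem_succ ha hb
    refine ⟨{c | v + 1 ≤ c.2}, Or.inl ⟨by simp, by simp, ?_⟩, ?_, ?_⟩
    · rintro ⟨x1, x2⟩ hx ⟨y1, y2⟩ hy hd hxO hyO
      simp only [IsDir, Prod.mk_sub_mk, Prod.mk.injEq, mem_ofPred_eq] at *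
      obtain rfl : y1 = x1 := by omega
      obtain rfl : y2 = x2 + 1 := by omega
      obtain rfl : x2 = v := by omega
      have := fst_eq_of_mem_rootedArm_of_mem_succ hx hy
      omega
    · simp only [mem_ofPred_eq]; omega
    · simp only [mem_ofPred_eq]; omega

lemma exists_isCut_rootedArm {a b : ℤ × ℤ} (ha : a ∈ rootedArm k) (hb : b ∈ rootedArm k)
    (hab : IsDir (b - a)) :
    ∃ O, (IsCut (rootedArm k) a b O ∨ IsCut (rootedArm k) b a O) ∧ (0, 0) ∉ O ∧
      (0, 2 * (k : ℤ) + 3) ∈ O := by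
  rcases hab with h | h | h | h
  · exact exists_isCut_rootedArm_of_le ha hb (Or.inl h)
  · obtain ⟨O, hO, h'⟩ := exists_isCut_rootedArm_of_le hb ha
      (Or.inl (by rw [← neg_sub, h]; simp))
    exact ⟨O, hO.symm, h'⟩
  · exact exists_isCut_rootedArm_of_le ha hb (Or.inr h)
  · obtain ⟨O, hO, h'⟩ := exists_isCut_rootedArm_of_le hb ha
      (Or.inr (by rw [← neg_sub, h]; simp))
    exact ⟨O, hO.symm, h'⟩

/-- A set of squares that is closed under adjacency in the arm contains all of the arm or nothing. -/
lemma mem_iff_of_mem_rootedArm {S : Set (ℤ × ℤ)}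
    (hS : ∀ x ∈ rootedArm k, ∀ y ∈ rootedArm k, IsDir (y - x) → x ∈ S → y ∈ S) {p : ℤ × ℤ}
    (hp : p ∈ rootedArm k) : p ∈ S ↔ (0, 0) ∈ S := by
  have hS' : ∀ x ∈ rootedArm k, ∀ y ∈ rootedArm k, IsDir (y - x) → (y ∈ S ↔ x ∈ S) :=
    fun x hx y hy h => ⟨hS y hy x hx h.sub_comm, hS x hx y hy h⟩
  have hrun : ∀ j : ℕ, j ≤ k → ∀ u ∈ uIcc (snakeTurn k j) (snakeTurn k (j + 1)),
      ((u, 2 * (j : ℤ) + 2) ∈ S ↔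
        (min (snakeTurn k j) (snakeTurn k (j + 1)), 2 * (j : ℤ) + 2) ∈ S) := by
    intro j hj u hu
    obtain ⟨h1, h2⟩ := hu
    revert h2
    induction u, h1 using Int.leInduction with
    | base => exact fun _ => Iff.rfl
    | succ u hu ih =>
      intro h2
      have h3 : u ≤ snakeTurn k j ⊔ snakeTurn k (j + 1) := by linarith
      rw [← ih h3]
      refine hS' _ (Or.inr (mem_snakeArm.2 (Or.inr ⟨j, hj, ⟨hu, h3⟩, rfl⟩))) _
        (Or.inr (mem_snakeArm.2 (Or.inr ⟨j, hj, ⟨by linarith, h2⟩, rfl⟩))) ?_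
      simp [IsDir]
  have hrun' : ∀ j : ℕ, j ≤ k → ∀ u ∈ uIcc (snakeTurn k j) (snakeTurn k (j + 1)),
      ((u, 2 * (j : ℤ) + 2) ∈ S ↔ (snakeTurn k j, 2 * (j : ℤ) + 1) ∈ S) := by
    intro j hj u hu
    rw [hrun j hj u hu, ← hrun j hj _ left_mem_uIcc]
    refine hS' _ (Or.inr (mem_snakeArm.2 (Or.inl ⟨j, by omega, rfl, rfl⟩))) _
        (Or.inr (mem_snakeArm.2 (Or.inr ⟨j, hj, left_mem_uIcc, rfl⟩))) ?_
    simp [IsDir]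
  have hlink : ∀ j : ℕ, j ≤ k + 1 → ((snakeTurn k j, 2 * (j : ℤ) + 1) ∈ S ↔ (0, 0) ∈ S) := by
    intro j
    induction j with
    | zero =>
      intro _
      refine hS' _ (Or.inl rfl) _ (Or.inr (mem_snakeArm.2 (Or.inl ⟨0, by omega, rfl, rfl⟩))) ?_
      simp [IsDir, snakeTurn_zero]
    | succ j ih =>
      intro hj
      rw [← ih (by omega), ← hrun' j (by omega) _ right_mem_uIcc]
      refine hS' _ (Or.inr (mem_snakeArm.2 (Or.inr ⟨j, by omega, right_mem_uIcc, rfl⟩))) _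
        (Or.inr (mem_snakeArm.2 (Or.inl ⟨j + 1, hj, rfl, rfl⟩))) ?_
      simp [IsDir]
      omega
  rcases hp with rfl | hp
  · rfl
  · obtain ⟨u, v⟩ := p
    rcases mem_snakeArm.1 hp with ⟨j, hj, rfl, rfl⟩ | ⟨j, hj, hu, rfl⟩
    · exact hlink j hj
    · rw [hrun' j hj u hu, hlink j (by omega)]

/-! ### Four turned arms make a cross pattern -/

/-- Coordinates of a square relative to the central square `(h, h)`, turned such that `d` points
upwards. -/
def frame (h : ℤ) (d c : ℤ × ℤ) : ℤ × ℤ :=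
  ((c.1 - h) * d.2 - (c.2 - h) * d.1, (c.1 - h) * d.1 + (c.2 - h) * d.2)

/-- The inverse of `frame`. -/
def unframe (h : ℤ) (d p : ℤ × ℤ) : ℤ × ℤ :=
  (h + p.1 * d.2 + p.2 * d.1, h - p.1 * d.1 + p.2 * d.2)

lemma frame_unframe {h : ℤ} {d : ℤ × ℤ} (hd : IsDir d) (p : ℤ × ℤ) :
    frame h d (unframe h d p) = p := by
  rcases hd with rfl | rfl | rfl | rfl <;> ext <;> simp [frame, unframe]

lemma unframe_frame {h : ℤ} {d : ℤ × ℤ} (hd : IsDir d) (p : ℤ × ℤ) :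
    unframe h d (frame h d p) = p := by
  rcases hd with rfl | rfl | rfl | rfl <;> ext <;> simp [frame, unframe]

lemma isDir_frame_sub {h : ℤ} {d : ℤ × ℤ} (hd : IsDir d) {x y : ℤ × ℤ} (hxy : IsDir (y - x)) :
    IsDir (frame h d y - frame h d x) := by
  obtain ⟨x1, x2⟩ := x
  obtain ⟨y1, y2⟩ := y
  rcases hd with rfl | rfl | rfl | rfl <;>
    simp only [frame, IsDir, Prod.mk_sub_mk, Prod.mk.injEq] at * <;> omega

lemma isDir_unframe_sub {h : ℤ} {d : ℤ × ℤ} (hd : IsDir d) {x y : ℤ × ℤ} (hxy : IsDir (y - x)) :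
    IsDir (unframe h d y - unframe h d x) := by
  obtain ⟨x1, x2⟩ := x
  obtain ⟨y1, y2⟩ := y
  rcases hd with rfl | rfl | rfl | rfl <;>
    simp only [unframe, IsDir, Prod.mk_sub_mk, Prod.mk.injEq] at * <;> omega

/-- The four rotations of the definition become one condition over the directions; the central
square lies in all four rooted arms. -/
lemma mem_snakeCross {c : ℤ × ℤ} : c ∈ snakeCross k ↔
    ∃ d, IsDir d ∧ frame (2 * k + 3) d c ∈ rootedArm k := by
  obtain ⟨c1, c2⟩ := c
  simp only [snakeCross, mem_ofPred_eq, Prod.mk.injEq, rootedArm, mem_insert_iff, frame]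
  constructor
  · rintro ⟨u, v, ⟨rfl, rfl⟩, h | h | h | h | h⟩
    · exact ⟨(0, 1), by simp [IsDir], Or.inl ⟨by simp [h.1], by simp [h.2]⟩⟩
    · exact ⟨(0, 1), by simp [IsDir], Or.inr (by simpa using h)⟩
    · exact ⟨(-1, 0), by simp [IsDir], Or.inr (by simpa using h)⟩
    · exact ⟨(0, -1), by simp [IsDir], Or.inr (by simpa using h)⟩
    · exact ⟨(1, 0), by simp [IsDir], Or.inr (by simpa using h)⟩
  · rintro ⟨d, rfl | rfl | rfl | rfl, h⟩ <;>
      refine ⟨c1 - (2 * k + 3), c2 - (2 * k + 3), by simp, ?_⟩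
    · rcases h with h | h
      · left; constructor <;> linarith [h.1, h.2]
      · exact Or.inr (Or.inr (Or.inr (Or.inr (by simpa using h))))
    · rcases h with h | h
      · left; constructor <;> linarith [h.1, h.2]
      · exact Or.inr (Or.inr (Or.inl (by simpa using h)))
    · rcases h with h | h
      · left; constructor <;> linarith [h.1, h.2]
      · exact Or.inr (Or.inl (by simpa using h))
    · rcases h with h | h
      · left; constructor <;> linarith [h.1, h.2]
      · exact Or.inr (Or.inr (Or.inr (Or.inl (by simpa using h))))

/-- Squares in different arms are neither equal nor adjacent. -/
lemma eq_of_mem_snakeArm {h : ℤ} {d e x y : ℤ × ℤ} (hd : IsDir d) (he : IsDir e)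
    (hx : frame h d x ∈ snakeArm k) (hy : frame h e y ∈ snakeArm k)
    (hxy : x = y ∨ IsDir (y - x)) : d = e := by
  -- Squares of different arms are strictly on opposite sides of a diagonal, so `u - v` or `u + v`
  -- differs by at least two, while a step changes it by one.
  have h1 := snakeArm_bounds hx
  have h2 := snakeArm_bounds hy
  obtain ⟨x1, x2⟩ := x
  obtain ⟨y1, y2⟩ := y
  rcases hd with rfl | rfl | rfl | rfl <;> rcases he with rfl | rfl | rfl | rfl <;>
    simp only [IsDir, Prod.mk_sub_mk, Prod.mk.injEq] at * <;> omega

/-- Different arms do not touch, and the centre belongs to every rooted arm. -/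
lemma exists_frame_mem_rootedArm {x y : ℤ × ℤ} (hx : x ∈ snakeCross k) (hy : y ∈ snakeCross k)
    (hxy : IsDir (y - x)) : ∃ d, IsDir d ∧ frame (2 * k + 3) d x ∈ rootedArm k ∧
      frame (2 * k + 3) d y ∈ rootedArm k := by
  have hzero : ∀ {d e c : ℤ × ℤ}, IsDir d → frame (2 * k + 3) d c = (0, 0) →
      frame (2 * k + 3) e c = (0, 0) := by
    intro d e c hd h
    have := unframe_frame (h := 2 * (k : ℤ) + 3) hd c
    rw [← this, h]
    ext <;> simp [frame, unframe]
  obtain ⟨d, hd, hxd⟩ := mem_snakeCross.1 hx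
  obtain ⟨e, he, hye⟩ := mem_snakeCross.1 hy
  rcases hxd with hx0 | hxd
  · exact ⟨e, he, Or.inl (hzero hd hx0), hye⟩
  rcases hye with hy0 | hye
  · exact ⟨d, hd, Or.inr hxd, Or.inl (hzero he hy0)⟩
  obtain rfl := eq_of_mem_snakeArm hd he hxd hye (Or.inr hxy)
  exact ⟨d, hd, Or.inr hxd, Or.inr hye⟩

lemma frame_exitSquare {d : ℤ × ℤ} (hd : IsDir d) (h : ℤ) :
    frame h d (exitSquare h d) = (0, h) := by
  rcases hd with rfl | rfl | rfl | rfl <;> simp [frame, exitSquare]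

lemma top_mem_snakeArm (k : ℕ) : (0, 2 * (k : ℤ) + 3) ∈ snakeArm k :=
  mem_snakeArm.2 (Or.inl ⟨k + 1, le_rfl, (snakeTurn_last k).symm, by push_cast; ring⟩)

/-- An edge in the arm towards `d` cuts the pattern such that just the exit at `d` is outside. -/
lemma exists_isCut_snakeCross {a b d : ℤ × ℤ} (hd : IsDir d)
    (ha : frame (2 * k + 3) d a ∈ rootedArm k) (hb : frame (2 * k + 3) d b ∈ rootedArm k)
    (hab : IsDir (b - a)) :
    ∃ C, (IsCut (snakeCross k) a b C ∨ IsCut (snakeCross k) b a C) ∧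
      ∀ e, IsDir e → (exitSquare (2 * k + 3) e ∈ C ↔ e = d) := by
  set f := frame (2 * (k : ℤ) + 3) d with hf
  have hinj : ∀ x y, f x = f y → x = y := fun x y h => by
    rw [← unframe_frame hd x, ← unframe_frame hd y]
    exact congrArg _ h
  obtain ⟨O, hO, h0, htop⟩ := exists_isCut_rootedArm ha hb (isDir_frame_sub hd hab)
  have key : ∀ a b : ℤ × ℤ, f a ∈ rootedArm k → f b ∈ rootedArm k →
      IsCut (rootedArm k) (f a) (f b) O →
      IsCut (snakeCross k) a b {c | f c ∈ snakeArm k ∧ f c ∈ O} := by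
    intro a b ha hb hO
    refine ⟨fun h => hO.notMem h.2, ⟨hb.resolve_left ?_, hO.mem⟩, ?_⟩
    · intro h
      exact h0 (h ▸ hO.mem)
    · rintro x hx y hy hxy hxO ⟨hyA, hyO⟩
      obtain ⟨e, he, hxe, hye⟩ := exists_frame_mem_rootedArm hx hy hxy
      have hye' : frame (2 * k + 3) e y ∈ snakeArm k := by
        refine hye.resolve_left fun h => ?_
        have h1 := unframe_frame (h := 2 * (k : ℤ) + 3) he y
        rw [h] at h1
        have h2 : f y = (0, 0) := by
          rw [← h1, hf]
          ext <;> simp [frame, unframe]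
        exact h0 (h2 ▸ hyO)
      obtain rfl := eq_of_mem_snakeArm hd he hyA hye' (Or.inl rfl)
      have hxO' : f x ∉ O := by
        rcases hxe with hxe | hxe
        · rw [hf, hxe]; exact h0
        · exact fun h => hxO ⟨hxe, h⟩
      obtain ⟨h1, h2⟩ := hO.eq_of_cross _ hxe _ hye (isDir_frame_sub hd hxy) hxO' hyO
      exact ⟨hinj _ _ h1, hinj _ _ h2⟩
  refine ⟨{c | f c ∈ snakeArm k ∧ f c ∈ O}, hO.imp (key a b ha hb) (key b a hb ha), ?_⟩
  intro e he
  constructor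
  · rintro ⟨h, -⟩
    refine (eq_of_mem_snakeArm hd he h ?_ (Or.inl rfl)).symm
    rw [frame_exitSquare he]
    exact top_mem_snakeArm k
  · rintro rfl
    simp only [mem_ofPred_eq, hf, frame_exitSquare hd]
    exact ⟨top_mem_snakeArm k, htop⟩

theorem isCross_snakeCross (k : ℕ) : IsCross (2 * k + 3) (snakeCross k) where
  pos := by positivity
  bounds := by
    intro w hw
    obtain ⟨d, hd, hw | hw⟩ := mem_snakeCross.1 hw
    · have := unframe_frame (h := 2 * (k : ℤ) + 3) hd w
      rw [← this, hw]
      simp only [unframe]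
      omega
    · have := snakeArm_bounds hw
      obtain ⟨w1, w2⟩ := w
      rcases hd with rfl | rfl | rfl | rfl <;> simp only at * <;> omega
  border := by
    intro w hw
    obtain ⟨d, hd, hw | hw⟩ := mem_snakeCross.1 hw
    · have := unframe_frame (h := 2 * (k : ℤ) + 3) hd w
      rw [← this, hw]
      simp only [unframe]
      omega
    · have := snakeArm_bounds hw
      obtain ⟨w1, w2⟩ := w
      rcases hd with rfl | rfl | rfl | rfl <;> simp only at * <;> omega
  exit_mem := by
    intro d hd
    exact mem_snakeCross.2 ⟨d, hd, Or.inr (by rw [frame_exitSquare hd]; exact top_mem_snakeArm k)⟩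
  connected := by
    intro S hS x hx hxS y hy
    have key : ∀ c ∈ snakeCross k, c ∈ S ↔ (2 * (k : ℤ) + 3, 2 * (k : ℤ) + 3) ∈ S := by
      intro c hc
      obtain ⟨d, hd, hcd⟩ := mem_snakeCross.1 hc
      have := mem_iff_of_mem_rootedArm (S := {p | unframe (2 * (k : ℤ) + 3) d p ∈ S}) ?_ hcd
      · rw [mem_ofPred_eq, unframe_frame hd] at this
        rw [this]
        simp [unframe]
      · intro p hp q hq hpq hpS
        exact hS _ (mem_snakeCross.2 ⟨d, hd, by rwa [frame_unframe hd]⟩) _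
          (mem_snakeCross.2 ⟨d, hd, by rwa [frame_unframe hd]⟩) (isDir_unframe_sub hd hpq) hpS
    exact (key y hy).2 ((key x hx).1 hxS)
  cut := by
    intro a ha b hb hab
    obtain ⟨d, hd, hda, hdb⟩ := exists_frame_mem_rootedArm ha hb hab
    obtain ⟨C, hC, h⟩ := exists_isCut_snakeCross hd hda hdb hab
    exact ⟨C, d, hd, hC, h⟩

/-- `w` is a square of the pattern `A` two neighbours of which are reached over edges that cut off
just the exit at `d`. -/
def IsPassage (h : ℤ) (A : Set (ℤ × ℤ)) (d w : ℤ × ℤ) : Prop :=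
  w ∈ A ∧ ∃ e, IsDir e ∧ ∀ s, s = e ∨ s = -e → w + s ∈ A ∧
    ∃ C, (IsCut A w (w + s) C ∨ IsCut A (w + s) w C) ∧
      ∀ e', IsDir e' → (exitSquare h e' ∈ C ↔ e' = d)

/-- For these `j` both ends of the run are proper turns, of opposite signs and of absolute values `2
j - 1` and `2 j + 1`. The first and the last run are excluded, having an end at `0`. -/
lemma mem_uIcc_snakeTurn {j : ℕ} (hj : 1 ≤ j) (hjk : j < k) {u : ℤ} (h1 : -(2 * (j : ℤ) - 1) ≤ u)
    (h2 : u ≤ 2 * (j : ℤ) - 1) : u ∈ uIcc (snakeTurn k j) (snakeTurn k (j + 1)) := by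
  have e1 : snakeTurn k j = (-1) ^ (j + 1) * (2 * (j : ℤ) - 1) := if_neg (by omega)
  have e2 : snakeTurn k (j + 1) = (-1) ^ (j + 1 + 1) * (2 * ((j + 1 : ℕ) : ℤ) - 1) :=
    if_neg (by omega)
  rw [mem_uIcc, e1, e2, pow_succ (-1 : ℤ) (j + 1)]
  push_cast
  rcases neg_one_pow_eq_or ℤ (j + 1) with h | h <;> rw [h] <;> omega

/-- The pattern has many squares that are passed on the way to the exit at `d`. -/
lemma exists_finset_isPassage (k : ℕ) {d : ℤ × ℤ} (hd : IsDir d) :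
    ∃ T : Finset (ℤ × ℤ), (k - 1) ^ 2 ≤ T.card ∧
      ∀ w ∈ T, IsPassage (2 * k + 3) (snakeCross k) d w := by
  -- Row `i` stands for the run `j = i + 1` at height `2 i + 4`. The range `|u| ≤ 2 i` stops one
  -- short of `2 j - 1`, so that both neighbours along the run are white. The rows have `4 i + 1`
  -- squares, in all at least `(k - 1) ^ 2`.
  let R : Finset (Σ _ : ℕ, ℤ) := (Finset.range (k - 1)).sigma fun i =>
    Finset.Icc (-(2 * (i : ℤ))) (2 * i)
  let g : (Σ _ : ℕ, ℤ) → ℤ × ℤ := fun s => unframe (2 * k + 3) d (s.2, 2 * (s.1 : ℤ) + 4)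
  have hg : Function.Injective g := by
    rintro ⟨i, u⟩ ⟨j, v⟩ h
    have := congrArg (frame (2 * (k : ℤ) + 3) d) h
    simp only [g, frame_unframe hd, Prod.mk.injEq] at this
    obtain rfl : i = j := by omega
    rw [this.1]
  refine ⟨R.image g, ?_, ?_⟩
  · rw [Finset.card_image_of_injective _ hg, Finset.card_sigma]
    generalize k - 1 = n
    induction n with
    | zero => simp
    | succ n ih =>
      rw [Finset.sum_range_succ]
      have : (Finset.Icc (-(2 * (n : ℤ))) (2 * n)).card = 4 * n + 1 := by
        rw [Int.card_Icc]; omega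
      rw [this]
      nlinarith
  · intro w hw
    obtain ⟨⟨i, u⟩, hs, rfl⟩ := Finset.mem_image.1 hw
    simp only [R, Finset.mem_sigma, Finset.mem_range, Finset.mem_Icc] at hs
    have hmem : ∀ v : ℤ, u - 1 ≤ v → v ≤ u + 1 → (v, 2 * (i : ℤ) + 4) ∈ rootedArm k := by
      intro v h1 h2
      refine Or.inr (mem_snakeArm.2 (Or.inr ⟨i + 1, by omega, ?_, by push_cast; ring⟩))
      refine mem_uIcc_snakeTurn (by omega) (by omega) ?_ ?_ <;> push_cast <;> omega
    have hmem' : ∀ v : ℤ, u - 1 ≤ v → v ≤ u + 1 →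
        unframe (2 * k + 3) d (v, 2 * (i : ℤ) + 4) ∈ snakeCross k := fun v h1 h2 =>
      mem_snakeCross.2 ⟨d, hd, by rw [frame_unframe hd]; exact hmem v h1 h2⟩
    refine ⟨hmem' u (by omega) (by omega), (d.2, -d.1), ?_, ?_⟩
    · rcases hd with rfl | rfl | rfl | rfl <;> simp [IsDir]
    · intro s hs'
      have hadd : ∃ v, u - 1 ≤ v ∧ v ≤ u + 1 ∧ IsDir ((v, 2 * (i : ℤ) + 4) - (u, 2 * (i : ℤ) + 4)) ∧
          g ⟨i, u⟩ + s = unframe (2 * k + 3) d (v, 2 * (i : ℤ) + 4) := by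
        rcases hs' with rfl | rfl
        · refine ⟨u + 1, by omega, by omega, by simp [IsDir], ?_⟩
          ext <;> simp [g, unframe] <;> ring
        · refine ⟨u - 1, by omega, by omega, by simp [IsDir], ?_⟩
          ext <;> simp [g, unframe] <;> ring
      obtain ⟨v, hv1, hv2, hdir, hv⟩ := hadd
      rw [hv]
      refine ⟨hmem' v hv1 hv2, exists_isCut_snakeCross hd ?_ ?_ (isDir_unframe_sub hd hdir)⟩
      · rw [frame_unframe hd]; exact hmem u (by omega) (by omega)
      · rw [frame_unframe hd]; exact hmem v hv1 hv2

end Snake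

/-! ### The level trees and the middles of their edges -/

section Levels

/-- The white squares of level `n` of the snake cross fractal. -/
abbrev snakeSquares (n : ℕ) : Set (ℤ × ℤ) := whiteSquares snakeWidth snakeCross n

/-- The width of the grid of level `n`. -/
abbrev snakeTotal (n : ℕ) : ℕ := totalWidth snakeWidth n

/-- The number of columns to the left of the middle one in the `(n + 1)`-st snake cross pattern. -/
def snakeHalf (n : ℕ) : ℤ := 2 * ((n + 1 : ℕ) : ℤ) + 3

lemma snakeWidth_succ (n : ℕ) : (snakeWidth (n + 1) : ℤ) = 2 * snakeHalf n + 1 := by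
  simp only [snakeWidth, snakeHalf]
  push_cast
  ring

lemma snakeTotal_succ (n : ℕ) : snakeTotal (n + 1) = snakeTotal n * snakeWidth (n + 1) := by
  simp only [snakeTotal, totalWidth]
  rw [Finset.prod_Icc_succ_top (by omega)]

lemma snakeTotal_succ_real (n : ℕ) :
    (snakeTotal (n + 1) : ℝ) = (2 * snakeHalf n + 1) * snakeTotal n := by
  rw [snakeTotal_succ, Nat.cast_mul, mul_comm]
  congr 1
  exact_mod_cast snakeWidth_succ n

lemma snakeTotal_pos (n : ℕ) : 0 < snakeTotal n :=
  Finset.prod_pos fun k _ => by simp [snakeWidth]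

lemma snakeTotal_pos_real (n : ℕ) : (0 : ℝ) < snakeTotal n := by exact_mod_cast snakeTotal_pos n

lemma two_pow_le_snakeTotal (n : ℕ) : 2 ^ n ≤ snakeTotal n := by
  induction n with
  | zero => simp [totalWidth]
  | succ n ih =>
    rw [snakeTotal_succ, pow_succ]
    exact Nat.mul_le_mul ih (by simp only [snakeWidth]; omega)

lemma tendsto_snakeTotal : Tendsto (fun n => (snakeTotal n : ℝ)) atTop atTop :=
  tendsto_atTop_mono (fun n => by exact_mod_cast two_pow_le_snakeTotal n)
    (tendsto_pow_atTop_atTop_of_one_lt (one_lt_two : (1 : ℝ) < 2))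

lemma isCross_succ (n : ℕ) : IsCross (snakeHalf n) (snakeCross (n + 1)) :=
  isCross_snakeCross (n + 1)

lemma snakeSquares_succ (n : ℕ) : snakeSquares (n + 1) =
    substitution (snakeHalf n) (snakeSquares n) (snakeCross (n + 1)) := by
  ext c
  simp only [snakeSquares, whiteSquares, substitution, subSquare, mem_ofPred_eq, snakeWidth_succ]

lemma gridConnected_snakeSquares (n : ℕ) : GridConnected (snakeSquares n) := by
  induction n with
  | zero =>
    rintro S - x rfl hx y rfl
    exact hx
  | succ n ih =>
    rw [snakeSquares_succ]
    exact (isCross_succ n).gridConnected_substitution ih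

lemma gridAcyclic_snakeSquares (n : ℕ) : GridAcyclic (snakeSquares n) := by
  induction n with
  | zero =>
    rintro a rfl b rfl h
    simp [IsDir, Prod.ext_iff] at h
  | succ n ih =>
    rw [snakeSquares_succ]
    exact (isCross_succ n).gridAcyclic_substitution ih

lemma finite_snakeSquares (n : ℕ) : (snakeSquares n).Finite := by
  induction n with
  | zero => exact finite_singleton _
  | succ n ih =>
    have hA : (snakeCross (n + 1)).Finite := by
      refine (finite_Icc ((0, 0) : ℤ × ℤ) (2 * snakeHalf n, 2 * snakeHalf n)).subset fun w hw => ?_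
      obtain ⟨h1, h2, h3, h4⟩ := (isCross_succ n).bounds w hw
      exact ⟨⟨h1, h3⟩, ⟨h2, h4⟩⟩
    refine (ih.image2 (subSquare (snakeHalf n)) hA).subset ?_
    rw [snakeSquares_succ]
    rintro _ ⟨q, hq, w, hw, rfl⟩
    exact ⟨q, hq, w, hw, rfl⟩

lemma mem_gridSquare {n : ℕ} {c : ℤ × ℤ} {p : Plane} : p ∈ gridSquare (snakeTotal n) c ↔
    ((c.1 : ℝ) ≤ snakeTotal n * p 0 ∧ snakeTotal n * p 0 ≤ c.1 + 1) ∧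
      ((c.2 : ℝ) ≤ snakeTotal n * p 1 ∧ snakeTotal n * p 1 ≤ c.2 + 1) := by
  have h := snakeTotal_pos_real n
  simp only [gridSquare, mem_ofPred_eq, div_le_iff₀ h, le_div_iff₀ h, mul_comm _ (snakeTotal n : ℝ),
    and_assoc]

lemma le_and_le_of_subinterval {h q w : ℤ} {t : ℝ} (h0 : 0 ≤ w) (h1 : w ≤ 2 * h)
    (ht1 : (((2 * h + 1) * q + w : ℤ) : ℝ) ≤ (2 * h + 1) * t)
    (ht2 : (2 * h + 1) * t ≤ (((2 * h + 1) * q + w : ℤ) : ℝ) + 1) : (q : ℝ) ≤ t ∧ t ≤ q + 1 := by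
  push_cast at ht1 ht2
  have h0' : (0 : ℝ) ≤ w := by exact_mod_cast h0
  have h1' : (w : ℝ) ≤ 2 * h := by exact_mod_cast h1
  have hpos : (0 : ℝ) < 2 * h + 1 := by linarith
  constructor
  · refine le_of_mul_le_mul_left ?_ hpos
    linarith
  · refine le_of_mul_le_mul_left ?_ hpos
    linarith

lemma mem_gridSquare_of_mem_subSquare {n : ℕ} {q w : ℤ × ℤ} {p : Plane}
    (hw : w ∈ snakeCross (n + 1))
    (hp : p ∈ gridSquare (snakeTotal (n + 1)) (subSquare (snakeHalf n) q w)) :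
    p ∈ gridSquare (snakeTotal n) q := by
  obtain ⟨b1, b2, b3, b4⟩ := (isCross_succ n).bounds w hw
  rw [mem_gridSquare, snakeTotal_succ_real, mul_assoc, mul_assoc] at hp
  rw [mem_gridSquare]
  exact ⟨le_and_le_of_subinterval b1 b2 hp.1.1 hp.1.2,
    le_and_le_of_subinterval b3 b4 hp.2.1 hp.2.2⟩

lemma levelSet_antitone : Antitone (levelSet snakeWidth snakeCross) := by
  refine antitone_nat_of_succ_le fun n p hp => ?_
  simp only [levelSet, mem_iUnion, exists_prop] at hp ⊢
  obtain ⟨c, hc, hp⟩ := hp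
  have hc' : c ∈ snakeSquares (n + 1) := hc
  rw [snakeSquares_succ] at hc'
  obtain ⟨q, hq, w, hw, rfl⟩ := hc'
  exact ⟨q, hq, mem_gridSquare_of_mem_subSquare hw hp⟩

/-- Level `0` may be included because the levels decrease; inductions can then start from the unit
square. -/
lemma mem_snakeFractal {p : Plane} : p ∈ snakeFractal ↔
    ∀ n, ∃ q ∈ snakeSquares n, p ∈ gridSquare (snakeTotal n) q := by
  have : p ∈ snakeFractal ↔ ∀ n, p ∈ levelSet snakeWidth snakeCross n := by
    simp only [snakeFractal, limitSet, mem_iInter]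
    exact ⟨fun h n => levelSet_antitone (Nat.le_succ n) (h (n + 1) (Nat.succ_pos n)),
      fun h n _ => h n⟩
  rw [this]
  simp [levelSet, snakeSquares]

lemma isClosed_gridSquare (M : ℕ) (c : ℤ × ℤ) : IsClosed (gridSquare M c) := by
  have h0 : Continuous fun p : Plane => p 0 := by fun_prop
  have h1 : Continuous fun p : Plane => p 1 := by fun_prop
  exact (isClosed_le continuous_const h0).inter ((isClosed_le h0 continuous_const).inter
    ((isClosed_le continuous_const h1).inter (isClosed_le h1 continuous_const)))

lemma convex_gridSquare (M : ℕ) (c : ℤ × ℤ) : Convex ℝ (gridSquare M c) := by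
  have h : ∀ i, IsLinearMap ℝ fun p : Plane => p i := fun i =>
    ⟨fun _ _ => rfl, fun _ _ => rfl⟩
  exact (convex_halfSpace_ge (h 0) _).inter ((convex_halfSpace_le (h 0) _).inter
    ((convex_halfSpace_ge (h 1) _).inter (convex_halfSpace_le (h 1) _)))

/-- The midpoint of the centres of two squares of the `M × M` grid. -/
noncomputable def midpointOf (M : ℕ) (a b : ℤ × ℤ) : Plane :=
  !₂[((a.1 : ℝ) + b.1 + 1) / (2 * M), ((a.2 : ℝ) + b.2 + 1) / (2 * M)]

lemma eq_midpointOf {n : ℕ} {a b : ℤ × ℤ} {p : Plane} : p = midpointOf (snakeTotal n) a b ↔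
    2 * (snakeTotal n * p 0) = a.1 + b.1 + 1 ∧ 2 * (snakeTotal n * p 1) = a.2 + b.2 + 1 := by
  have h := snakeTotal_pos_real n
  have h2 : (2 * snakeTotal n : ℝ) ≠ 0 := by positivity
  constructor
  · rintro rfl
    simp only [midpointOf, PiLp.toLp_apply, Matrix.cons_val_zero, Matrix.cons_val_one]
    constructor <;> field_simp
  · rintro ⟨h0, h1⟩
    ext i
    fin_cases i
    · simp only [midpointOf, Fin.zero_eta, PiLp.toLp_apply, Matrix.cons_val_zero]
      rw [eq_div_iff h2]
      linarith
    · simp only [midpointOf, Fin.mk_one, PiLp.toLp_apply, Matrix.cons_val_one]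
      simp only [Matrix.cons_val_zero]
      rw [eq_div_iff h2]
      linarith

lemma midpointOf_comm (M : ℕ) (a b : ℤ × ℤ) : midpointOf M a b = midpointOf M b a := by
  simp only [midpointOf, add_comm (a.1 : ℝ), add_comm (a.2 : ℝ)]

lemma midpointOf_mem {n : ℕ} {a b : ℤ × ℤ} (h : IsDir (b - a)) :
    midpointOf (snakeTotal n) a b ∈ gridSquare (snakeTotal n) a := by
  obtain ⟨h0, h1⟩ := eq_midpointOf.1 (rfl : midpointOf (snakeTotal n) a b = _)
  rw [mem_gridSquare]
  obtain ⟨a1, a2⟩ := a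
  obtain ⟨b1, b2⟩ := b
  simp only [IsDir, Prod.mk_sub_mk, Prod.mk.injEq] at h h0 h1 ⊢
  have hb : ((b1 : ℝ) - a1 = 1 ∧ (b2 : ℝ) - a2 = 0) ∨ ((b1 : ℝ) - a1 = -1 ∧ (b2 : ℝ) - a2 = 0) ∨
      ((b1 : ℝ) - a1 = 0 ∧ (b2 : ℝ) - a2 = 1) ∨ ((b1 : ℝ) - a1 = 0 ∧ (b2 : ℝ) - a2 = -1) := by
    exact_mod_cast h
  rcases hb with hb | hb | hb | hb <;> refine ⟨⟨?_, ?_⟩, ?_, ?_⟩ <;> linarith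

lemma midpointOf_mem_right {n : ℕ} {a b : ℤ × ℤ} (h : IsDir (b - a)) :
    midpointOf (snakeTotal n) a b ∈ gridSquare (snakeTotal n) b := by
  rw [midpointOf_comm]
  exact midpointOf_mem h.sub_comm

lemma midpointOf_add_injective {n : ℕ} {q d e : ℤ × ℤ}
    (h : midpointOf (snakeTotal n) q (q + d) = midpointOf (snakeTotal n) q (q + e)) : d = e := by
  obtain ⟨h0, h1⟩ := eq_midpointOf.1 (rfl : midpointOf (snakeTotal n) q (q + d) = _)
  obtain ⟨h2, h3⟩ := eq_midpointOf.1 h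
  have e1 : (d.1 : ℝ) = e.1 := by
    have := h0.symm.trans h2
    push_cast [Prod.fst_add] at this
    linarith
  have e2 : (d.2 : ℝ) = e.2 := by
    have := h1.symm.trans h3
    push_cast [Prod.snd_add] at this
    linarith
  exact Prod.ext (by exact_mod_cast e1) (by exact_mod_cast e2)

lemma subSquare_add (h : ℤ) (q w s : ℤ × ℤ) : subSquare h q (w + s) = subSquare h q w + s := by
  ext <;> simp [subSquare, add_assoc]

/-- The middle of a side of a square is the middle of a side of the exit square inside. -/
lemma midpointOf_exitSquare (n : ℕ) (q d : ℤ × ℤ) :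
    midpointOf (snakeTotal n) q (q + d) = midpointOf (snakeTotal (n + 1))
      (subSquare (snakeHalf n) q (exitSquare (snakeHalf n) d))
      (subSquare (snakeHalf n) q (exitSquare (snakeHalf n) d) + d) := by
  obtain ⟨h0, h1⟩ := eq_midpointOf.1 (rfl : midpointOf (snakeTotal n) q (q + d) = _)
  rw [eq_midpointOf, snakeTotal_succ_real, mul_assoc, mul_assoc]
  simp only [subSquare, exitSquare, Prod.fst_add, Prod.snd_add, Int.cast_add, Int.cast_mul,
    Int.cast_one, Int.cast_ofNat] at h0 h1 ⊢
  constructor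
  · linear_combination (2 * (snakeHalf n : ℝ) + 1) * h0
  · linear_combination (2 * (snakeHalf n : ℝ) + 1) * h1

lemma midpointOf_mem_exitSquare {n : ℕ} {q d : ℤ × ℤ} (hd : IsDir d) :
    midpointOf (snakeTotal n) q (q + d) ∈ gridSquare (snakeTotal (n + 1))
      (subSquare (snakeHalf n) q (exitSquare (snakeHalf n) d)) := by
  rw [midpointOf_exitSquare]
  exact midpointOf_mem (by simpa using hd)

end Levels

/-! ### Points of the fractal on grid lines -/

section Geometry

/-- The distance of a real number to the nearest half-integer. -/
noncomputable def halfDist (t : ℝ) : ℝ := |t - 1 / 2 - round (t - 1 / 2)|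

lemma halfDist_le (t : ℝ) (b : ℤ) : halfDist t ≤ |t - (b + 1 / 2)| := by
  refine (round_le (t - 1 / 2) b).trans (le_of_eq ?_)
  congr 1
  ring

/-- Scaling by the odd number `2 h + 1` sends the middle of the interval from `b` to `b + 1` to the
middle of its middle part, and multiplies the distance to it by `2 h + 1 ≥ 3`. The hypothesis `hlt`
excludes the ends of that part, where the nearest half-integer is ambiguous. -/
lemma halfDist_scale {h b : ℤ} {t : ℝ} (hh : 0 < h)
    (h1 : (((2 * h + 1) * b + h : ℤ) : ℝ) ≤ (2 * h + 1) * t)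
    (h2 : (2 * h + 1) * t ≤ (((2 * h + 1) * b + h : ℤ) : ℝ) + 1)
    (hlt : halfDist ((2 * h + 1) * t) < 1 / 2) : 2 * halfDist t ≤ halfDist ((2 * h + 1) * t) := by
  have hh' : (1 : ℝ) ≤ h := by exact_mod_cast hh
  set r := round ((2 * (h : ℝ) + 1) * t - 1 / 2) with hr
  have hr' : halfDist ((2 * h + 1) * t) = |(2 * h + 1) * t - 1 / 2 - r| := rfl
  have hrc : r = (2 * h + 1) * b + h := by
    rw [hr'] at hlt
    have h3 := abs_lt.1 hlt
    have h4 : (r : ℝ) - ((2 * h + 1) * b + h : ℤ) < 1 := by linarith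
    have h5 : (((2 * h + 1) * b + h : ℤ) : ℝ) - r < 1 := by linarith
    have h4' : r - ((2 * h + 1) * b + h) < 1 := by exact_mod_cast h4
    have h5' : ((2 * h + 1) * b + h) - r < 1 := by exact_mod_cast h5
    omega
  have h6 : halfDist ((2 * h + 1) * t) = (2 * h + 1) * |t - (b + 1 / 2)| := by
    rw [hr', hrc, ← abs_of_pos (show (0 : ℝ) < 2 * h + 1 by linarith), ← abs_mul,
      abs_of_pos (show (0 : ℝ) < 2 * h + 1 by linarith)]
    congr 1
    push_cast
    ring
  have h7 := halfDist_le t b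
  have h8 := abs_nonneg (t - (b + 1 / 2))
  rw [h6]
  nlinarith

/-- An integer in the `w`-th of the `2 h + 1` equal parts of the interval from `q` to `q + 1` lies in
the first or in the last of them. -/
lemma eq_zero_or_of_int {h q w a : ℤ} (h0 : 0 ≤ w) (h1 : w ≤ 2 * h)
    (h2 : (((2 * h + 1) * q + w : ℤ) : ℝ) ≤ (2 * h + 1) * (a : ℝ))
    (h3 : (2 * h + 1) * (a : ℝ) ≤ (((2 * h + 1) * q + w : ℤ) : ℝ) + 1) : w = 0 ∨ w = 2 * h := by
  have h2' : (2 * h + 1) * q + w ≤ (2 * h + 1) * a := by exact_mod_cast h2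
  have h3' : (2 * h + 1) * a ≤ (2 * h + 1) * q + w + 1 := by exact_mod_cast h3
  rcases lt_trichotomy a (q + 1) with hlt | heq | hlt
  · left; nlinarith
  · right; subst heq; linarith
  · nlinarith

/-- If `X` and `Y` are the rescaled coordinates of a point of the fractal in the grids of all
levels, and the first one is an integer at some level, then the second one is a half-integer. -/
lemma exists_half_int {h : ℕ → ℤ} (hh : ∀ n, 0 < h n) {X Y : ℕ → ℝ}
    (hX : ∀ n, X (n + 1) = (2 * h n + 1) * X n) (hY : ∀ n, Y (n + 1) = (2 * h n + 1) * Y n)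
    (H : ∀ n, ∃ q r w v : ℤ, 0 ≤ w ∧ w ≤ 2 * h n ∧ (w = 0 ∨ w = 2 * h n → v = h n) ∧
      ((((2 * h n + 1) * q + w : ℤ) : ℝ) ≤ X (n + 1) ∧
        X (n + 1) ≤ (((2 * h n + 1) * q + w : ℤ) : ℝ) + 1) ∧
      ((((2 * h n + 1) * r + v : ℤ) : ℝ) ≤ Y (n + 1) ∧
        Y (n + 1) ≤ (((2 * h n + 1) * r + v : ℤ) : ℝ) + 1)) {n : ℕ} {a : ℤ} (ha : X n = a) :
    ∃ b : ℤ, Y n = b + 1 / 2 := by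
  have hint : ∀ j, ∃ a : ℤ, X (n + j) = a := by
    intro j
    induction j with
    | zero => exact ⟨a, ha⟩
    | succ j ih =>
      obtain ⟨c, hc⟩ := ih
      exact ⟨(2 * h (n + j) + 1) * c, by rw [← add_assoc, hX, hc]; push_cast; ring⟩
  -- An integer `X` forces the digit `w` to be extreme, hence `v` to be the middle digit: `Y` lies
  -- in the middle part at every later level.
  have hmid : ∀ j, ∃ r : ℤ, (((2 * h (n + j) + 1) * r + h (n + j) : ℤ) : ℝ) ≤
      (2 * h (n + j) + 1) * Y (n + j) ∧
      (2 * h (n + j) + 1) * Y (n + j) ≤ (((2 * h (n + j) + 1) * r + h (n + j) : ℤ) : ℝ) + 1 := by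
    intro j
    obtain ⟨c, hc⟩ := hint j
    obtain ⟨q, r, w, v, h0, h1, hv, h2, h3⟩ := H (n + j)
    rw [hX, hc] at h2
    have := hv (eq_zero_or_of_int h0 h1 h2.1 h2.2)
    subst this
    rw [hY] at h3
    exact ⟨r, h3⟩
  have hlt : ∀ j, halfDist (Y (n + j)) < 1 / 2 := by
    intro j
    obtain ⟨r, h1, h2⟩ := hmid j
    have hh' : (1 : ℝ) ≤ h (n + j) := by exact_mod_cast hh (n + j)
    refine (halfDist_le _ r).trans_lt (abs_lt.2 ?_)
    push_cast at h1 h2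
    constructor <;> nlinarith
  have hdouble : ∀ j, 2 * halfDist (Y (n + j)) ≤ halfDist (Y (n + (j + 1))) := by
    intro j
    obtain ⟨r, h1, h2⟩ := hmid j
    rw [← add_assoc, hY]
    refine halfDist_scale (hh _) h1 h2 ?_
    rw [← hY]
    exact hlt (j + 1)
  have hpow : ∀ j, 2 ^ j * halfDist (Y n) ≤ halfDist (Y (n + j)) := by
    intro j
    induction j with
    | zero => simp
    | succ j ih =>
      calc 2 ^ (j + 1) * halfDist (Y n) = 2 * (2 ^ j * halfDist (Y n)) := by ring
        _ ≤ 2 * halfDist (Y (n + j)) := by linarith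
        _ ≤ _ := hdouble j
  -- A positive distance would double for ever while staying below `1 / 2`.
  have hzero : halfDist (Y n) ≤ 0 := by
    by_contra hpos
    push Not at hpos
    obtain ⟨j, hj⟩ := pow_unbounded_of_one_lt (1 / halfDist (Y n)) (one_lt_two : (1 : ℝ) < 2)
    rw [div_lt_iff₀ hpos] at hj
    linarith [hpow j, hlt j]
  have := abs_eq_zero.1 (le_antisymm hzero (abs_nonneg _))
  exact ⟨round (Y n - 1 / 2), by linarith⟩

/-- A point of the fractal on a grid line is in the middle of an edge of the grid. -/
lemma exists_half_int_of_mem {z : Plane} (hz : z ∈ snakeFractal) (n : ℕ) :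
    (∀ a : ℤ, snakeTotal n * z 0 = a → ∃ b : ℤ, snakeTotal n * z 1 = b + 1 / 2) ∧
      ∀ a : ℤ, snakeTotal n * z 1 = a → ∃ b : ℤ, snakeTotal n * z 0 = b + 1 / 2 := by
  have hX : ∀ i : Fin 2, ∀ n, (snakeTotal (n + 1) : ℝ) * z i =
      (2 * snakeHalf n + 1) * (snakeTotal n * z i) := by
    intro i n
    rw [snakeTotal_succ_real, mul_assoc]
  have key : ∀ n, ∃ q ∈ snakeSquares n, ∃ w ∈ snakeCross (n + 1),
      z ∈ gridSquare (snakeTotal (n + 1)) (subSquare (snakeHalf n) q w) := by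
    intro n
    obtain ⟨c, hc, hzc⟩ := mem_snakeFractal.1 hz (n + 1)
    rw [snakeSquares_succ] at hc
    obtain ⟨q, hq, w, hw, rfl⟩ := hc
    exact ⟨q, hq, w, hw, hzc⟩
  refine ⟨fun a ha => ?_, fun a ha => ?_⟩
  · refine exists_half_int (h := snakeHalf) (fun n => (isCross_succ n).pos)
      (X := fun n => snakeTotal n * z 0) (Y := fun n => snakeTotal n * z 1) (hX 0) (hX 1) ?_ ha
    intro n
    obtain ⟨q, hq, w, hw, h⟩ := key n
    rw [mem_gridSquare] at h
    obtain ⟨b1, b2, b3, b4⟩ := (isCross_succ n).bounds w hw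
    exact ⟨q.1, q.2, w.1, w.2, b1, b2, ((isCross_succ n).border w hw).1, h.1, h.2⟩
  · refine exists_half_int (h := snakeHalf) (fun n => (isCross_succ n).pos)
      (X := fun n => snakeTotal n * z 1) (Y := fun n => snakeTotal n * z 0) (hX 1) (hX 0) ?_ ha
    intro n
    obtain ⟨q, hq, w, hw, h⟩ := key n
    rw [mem_gridSquare] at h
    obtain ⟨b1, b2, b3, b4⟩ := (isCross_succ n).bounds w hw
    exact ⟨q.2, q.1, w.2, w.1, b3, b4, ((isCross_succ n).border w hw).2, h.2, h.1⟩

lemma int_eq_of_le_half_le {a b : ℤ} (h1 : (a : ℝ) ≤ b + 1 / 2) (h2 : (b : ℝ) + 1 / 2 ≤ a + 1) :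
    a = b := by
  have h3 : (a : ℝ) < b + 1 := by linarith
  have h4 : (b : ℝ) < a + 1 := by linarith
  have h3' : a < b + 1 := by exact_mod_cast h3
  have h4' : b < a + 1 := by exact_mod_cast h4
  omega

lemma int_eq_or_of_le_le {a b : ℤ} (h1 : (a : ℝ) ≤ b) (h2 : (b : ℝ) ≤ a + 1) :
    b = a ∨ b = a + 1 := by
  have h1' : a ≤ b := by exact_mod_cast h1
  have h2' : b ≤ a + 1 := by exact_mod_cast h2
  omega

lemma eq_sub_one_or_of_mem_mem {a b : ℤ} {t : ℝ} (hab : a ≠ b) (h1 : (a : ℝ) ≤ t)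
    (h2 : t ≤ a + 1) (h3 : (b : ℝ) ≤ t) (h4 : t ≤ b + 1) :
    (b = a + 1 ∧ t = b) ∨ (b = a - 1 ∧ t = a) := by
  have h5 : (a : ℝ) ≤ b + 1 := by linarith
  have h6 : (b : ℝ) ≤ a + 1 := by linarith
  have h5' : a ≤ b + 1 := by exact_mod_cast h5
  have h6' : b ≤ a + 1 := by exact_mod_cast h6
  have h7 : b = a + 1 ∨ b = a - 1 := by omega
  rcases h7 with rfl | rfl
  · left
    push_cast at *
    exact ⟨rfl, by linarith⟩
  · right
    push_cast at *
    exact ⟨rfl, by linarith⟩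

/-- Two squares of a level with a common point in the fractal are adjacent, and the point is the
middle of the common edge. -/
lemma isDir_of_mem_of_mem {z : Plane} (hz : z ∈ snakeFractal) {n : ℕ} {a b : ℤ × ℤ} (hab : a ≠ b)
    (ha : z ∈ gridSquare (snakeTotal n) a) (hb : z ∈ gridSquare (snakeTotal n) b) :
    IsDir (b - a) ∧ z = midpointOf (snakeTotal n) a b := by
  rw [mem_gridSquare] at ha hb
  obtain ⟨H1, H2⟩ := exists_half_int_of_mem hz n
  rw [eq_midpointOf]
  obtain ⟨a1, a2⟩ := a
  obtain ⟨b1, b2⟩ := b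
  simp only [IsDir, Prod.mk_sub_mk, Prod.mk.injEq] at *
  by_cases h1 : a1 = b1
  · have h2 : a2 ≠ b2 := fun h => hab (by rw [h1, h])
    subst h1
    rcases eq_sub_one_or_of_mem_mem h2 ha.2.1 ha.2.2 hb.2.1 hb.2.2 with ⟨h3, h4⟩ | ⟨h3, h4⟩
    · obtain ⟨c, hc⟩ := H2 _ h4
      obtain rfl := int_eq_of_le_half_le (hc ▸ ha.1.1) (hc ▸ ha.1.2)
      subst h3
      refine ⟨by omega, by rw [hc]; ring, by rw [h4]; push_cast; ring⟩
    · obtain ⟨c, hc⟩ := H2 _ h4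
      obtain rfl := int_eq_of_le_half_le (hc ▸ ha.1.1) (hc ▸ ha.1.2)
      subst h3
      refine ⟨by omega, by rw [hc]; ring, by rw [h4]; push_cast; ring⟩
  -- Different columns put `z` on a vertical grid line. Its second scaled coordinate is then a
  -- half-integer, which fixes the row, so squares touching at a corner are excluded.
  · rcases eq_sub_one_or_of_mem_mem h1 ha.1.1 ha.1.2 hb.1.1 hb.1.2 with ⟨h3, h4⟩ | ⟨h3, h4⟩
    · obtain ⟨c, hc⟩ := H1 _ h4
      obtain rfl := int_eq_of_le_half_le (hc ▸ ha.2.1) (hc ▸ ha.2.2)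
      obtain rfl := int_eq_of_le_half_le (hc ▸ hb.2.1) (hc ▸ hb.2.2)
      subst h3
      refine ⟨by omega, by rw [h4]; push_cast; ring, by rw [hc]; ring⟩
    · obtain ⟨c, hc⟩ := H1 _ h4
      obtain rfl := int_eq_of_le_half_le (hc ▸ ha.2.1) (hc ▸ ha.2.2)
      obtain rfl := int_eq_of_le_half_le (hc ▸ hb.2.1) (hc ▸ hb.2.2)
      subst h3
      refine ⟨by omega, by rw [h4]; push_cast; ring, by rw [hc]; ring⟩

/-- The point `z` lies on a line of the grid of level `n`. -/
def OnGrid (n : ℕ) (z : Plane) : Prop := ∃ i, ∃ a : ℤ, snakeTotal n * z i = a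

lemma OnGrid.mono {n n' : ℕ} {z : Plane} (h : OnGrid n z) (hn : n ≤ n') : OnGrid n' z := by
  induction n', hn using Nat.le_induction with
  | base => exact h
  | succ n' _ ih =>
    obtain ⟨i, a, ha⟩ := ih
    exact ⟨i, (2 * snakeHalf n' + 1) * a, by
      rw [snakeTotal_succ_real, mul_assoc, ha]; push_cast; ring⟩

lemma onGrid_midpointOf {n : ℕ} {q d : ℤ × ℤ} (hd : IsDir d) :
    OnGrid n (midpointOf (snakeTotal n) q (q + d)) := by
  obtain ⟨h0, h1⟩ := eq_midpointOf.1 (rfl : midpointOf (snakeTotal n) q (q + d) = _)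
  rcases hd with rfl | rfl | rfl | rfl
  · refine ⟨0, q.1 + 1, ?_⟩
    push_cast [Prod.fst_add] at h0 ⊢
    linarith
  · refine ⟨0, q.1, ?_⟩
    push_cast [Prod.fst_add] at h0 ⊢
    linarith
  · refine ⟨1, q.2 + 1, ?_⟩
    push_cast [Prod.snd_add] at h1 ⊢
    linarith
  · refine ⟨1, q.2, ?_⟩
    push_cast [Prod.snd_add] at h1 ⊢
    linarith

lemma OnGrid.exists_eq_midpointOf {n : ℕ} {z : Plane} (h : OnGrid n z) (hz : z ∈ snakeFractal)
    {q : ℤ × ℤ} (hq : z ∈ gridSquare (snakeTotal n) q) :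
    ∃ d, IsDir d ∧ z = midpointOf (snakeTotal n) q (q + d) := by
  rw [mem_gridSquare] at hq
  obtain ⟨H1, H2⟩ := exists_half_int_of_mem hz n
  obtain ⟨i, a, ha⟩ := h
  fin_cases i
  · simp only [Fin.zero_eta] at ha
    obtain ⟨c, hc⟩ := H1 _ ha
    have h2 := int_eq_of_le_half_le (hc ▸ hq.2.1) (hc ▸ hq.2.2)
    rcases int_eq_or_of_le_le (ha ▸ hq.1.1) (ha ▸ hq.1.2) with h1 | h1
    · refine ⟨(-1, 0), by simp [IsDir], eq_midpointOf.2 ⟨?_, ?_⟩⟩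
      · rw [ha, h1]; push_cast [Prod.fst_add]; ring
      · rw [hc, ← h2]; push_cast [Prod.snd_add]; ring
    · refine ⟨(1, 0), by simp [IsDir], eq_midpointOf.2 ⟨?_, ?_⟩⟩
      · rw [ha, h1]; push_cast [Prod.fst_add]; ring
      · rw [hc, ← h2]; push_cast [Prod.snd_add]; ring
  · simp only [Fin.mk_one] at ha
    obtain ⟨c, hc⟩ := H2 _ ha
    have h2 := int_eq_of_le_half_le (hc ▸ hq.1.1) (hc ▸ hq.1.2)
    rcases int_eq_or_of_le_le (ha ▸ hq.2.1) (ha ▸ hq.2.2) with h1 | h1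
    · refine ⟨(0, -1), by simp [IsDir], eq_midpointOf.2 ⟨?_, ?_⟩⟩
      · rw [hc, ← h2]; push_cast [Prod.fst_add]; ring
      · rw [ha, h1]; push_cast [Prod.snd_add]; ring
    · refine ⟨(0, 1), by simp [IsDir], eq_midpointOf.2 ⟨?_, ?_⟩⟩
      · rw [hc, ← h2]; push_cast [Prod.fst_add]; ring
      · rw [ha, h1]; push_cast [Prod.snd_add]; ring

/-- Two different points of the plane lie in no common square of a fine grid. -/
lemma exists_level_notMem {x y : Plane} (hxy : x ≠ y) : ∃ n₀, ∀ n ≥ n₀, ∀ q,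
    x ∈ gridSquare (snakeTotal n) q → y ∉ gridSquare (snakeTotal n) q := by
  obtain ⟨i, hi⟩ : ∃ i, x i ≠ y i := by
    by_contra h
    push Not at h
    exact hxy (PiLp.ext h)
  have hpos : 0 < |x i - y i| := abs_pos.2 (sub_ne_zero.2 hi)
  have hev := (tendsto_snakeTotal.atTop_mul_const hpos).eventually_gt_atTop 1
  obtain ⟨n₀, hn₀⟩ := eventually_atTop.1 hev
  refine ⟨n₀, fun n hn q hx hy => ?_⟩
  rw [mem_gridSquare] at hx hy
  have h1 := hn₀ n hn
  have h2 : |snakeTotal n * x i - snakeTotal n * y i| ≤ 1 := by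
    rw [abs_le]
    fin_cases i
    · simp only [Fin.zero_eta]
      constructor <;> linarith [hx.1.1, hx.1.2, hy.1.1, hy.1.2]
    · simp only [Fin.mk_one]
      constructor <;> linarith [hx.2.1, hx.2.2, hy.2.1, hy.2.2]
  rw [← mul_sub, abs_mul, abs_of_pos (snakeTotal_pos_real n)] at h2
  linarith

end Geometry

/-! ### Cut points of the fractal, connectedness and unique arcs -/

section Topology

/-- The union of the white squares of level `n` with positions in `C`. -/
def sideSet (n : ℕ) (C : Set (ℤ × ℤ)) : Set Plane :=
  ⋃ q ∈ snakeSquares n ∩ C, gridSquare (snakeTotal n) q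

lemma mem_sideSet {n : ℕ} {C : Set (ℤ × ℤ)} {z : Plane} : z ∈ sideSet n C ↔
    ∃ q ∈ snakeSquares n, q ∈ C ∧ z ∈ gridSquare (snakeTotal n) q := by
  simp only [sideSet, mem_iUnion, mem_inter_iff, exists_prop, and_assoc]

lemma isClosed_sideSet (n : ℕ) (C : Set (ℤ × ℤ)) : IsClosed (sideSet n C) :=
  ((finite_snakeSquares n).inter_of_left C).isClosed_biUnion fun _ _ => isClosed_gridSquare _ _

lemma levelSet_eq_sideSet (n : ℕ) : levelSet snakeWidth snakeCross n = sideSet n univ := by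
  simp only [levelSet, sideSet, inter_univ]

lemma snakeFractal_subset_sideSet_union (n : ℕ) (C : Set (ℤ × ℤ)) :
    snakeFractal ⊆ sideSet n C ∪ sideSet n Cᶜ := by
  intro z hz
  obtain ⟨q, hq, hzq⟩ := mem_snakeFractal.1 hz n
  by_cases hC : q ∈ C
  · exact Or.inl (mem_sideSet.2 ⟨q, hq, hC, hzq⟩)
  · exact Or.inr (mem_sideSet.2 ⟨q, hq, hC, hzq⟩)

/-- The two sides of a cut have only one point of the fractal in common. -/
lemma IsCut.eq_midpointOf {n : ℕ} {a b : ℤ × ℤ} {C : Set (ℤ × ℤ)}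
    (hC : IsCut (snakeSquares n) a b C) {z : Plane} (hz : z ∈ snakeFractal) (h1 : z ∈ sideSet n C)
    (h2 : z ∈ sideSet n Cᶜ) : z = midpointOf (snakeTotal n) a b := by
  obtain ⟨q, hq, hqC, hzq⟩ := mem_sideSet.1 h1
  obtain ⟨r, hr, hrC, hzr⟩ := mem_sideSet.1 h2
  have hqr : r ≠ q := by rintro rfl; exact hrC hqC
  obtain ⟨hdir, hzm⟩ := isDir_of_mem_of_mem hz hqr hzr hzq
  obtain ⟨rfl, rfl⟩ := hC.eq_of_cross r hr q hq hdir hrC hqC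
  exact hzm

/-- A connected part of the fractal that meets both sides of a cut contains the cut point. -/
lemma IsCut.cutPoint_mem {n : ℕ} {a b : ℤ × ℤ} {C : Set (ℤ × ℤ)}
    (hC : IsCut (snakeSquares n) a b C) {T : Set Plane} (hT : IsPreconnected T)
    (hTL : T ⊆ snakeFractal) {x y : Plane} (hx : x ∈ T) (hxC : x ∈ sideSet n Cᶜ) (hy : y ∈ T)
    (hyC : y ∈ sideSet n C) : midpointOf (snakeTotal n) a b ∈ T := by
  obtain ⟨z, hz, h1, h2⟩ := isPreconnected_closed_iff.1 hT _ _ (isClosed_sideSet n C)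
    (isClosed_sideSet n Cᶜ) (hTL.trans (snakeFractal_subset_sideSet_union n C)) ⟨y, hy, hyC⟩
    ⟨x, hx, hxC⟩
  rw [← hC.eq_midpointOf (hTL hz) h1 h2]
  exact hz

lemma isCompact_sideSet (n : ℕ) (C : Set (ℤ × ℤ)) : IsCompact (sideSet n C) := by
  refine ((finite_snakeSquares n).inter_of_left C).isCompact_biUnion fun q _ => ?_
  refine Metric.isCompact_of_isClosed_isBounded (isClosed_gridSquare _ _) ?_
  have himg : IsCompact ((fun f : Fin 2 → ℝ => (WithLp.toLp 2 f : Plane)) ''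
      (Set.pi univ fun i => Icc (![(q.1 : ℝ) / snakeTotal n, (q.2 : ℝ) / snakeTotal n] i)
        (![((q.1 : ℝ) + 1) / snakeTotal n, ((q.2 : ℝ) + 1) / snakeTotal n] i))) :=
    (isCompact_univ_pi fun _ => isCompact_Icc).image (PiLp.continuous_toLp 2 _)
  refine himg.isBounded.subset ?_
  rintro p ⟨h1, h2, h3, h4⟩
  refine ⟨p.ofLp, ?_, rfl⟩
  intro i _
  fin_cases i
  · exact ⟨h1, h2⟩
  · exact ⟨h3, h4⟩

/-- Adjacent squares are convex and share an edge middle, and the level is connected as a graph. -/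
lemma isPreconnected_levelSet (n : ℕ) : IsPreconnected (levelSet snakeWidth snakeCross n) := by
  refine IsPreconnected.biUnion_of_reflTransGen
    (fun q _ => (convex_gridSquare _ q).isPreconnected) fun q hq r hr => ?_
  have := gridConnected_snakeSquares n
    {s | Relation.ReflTransGen (fun i j : ℤ × ℤ => (gridSquare (snakeTotal n) i ∩
      gridSquare (snakeTotal n) j).Nonempty ∧ i ∈ snakeSquares n) q s} ?_ q hq .refl r hr
  · exact this
  · intro x hx y hy hxy hqx
    exact Relation.ReflTransGen.tail hqx ⟨⟨_, midpointOf_mem hxy, midpointOf_mem_right hxy⟩, hx⟩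

lemma isClosed_snakeFractal : IsClosed snakeFractal :=
  isClosed_biInter fun n _ => by
    rw [levelSet_eq_sideSet]
    exact isClosed_sideSet n univ

lemma isCompact_snakeFractal : IsCompact snakeFractal := by
  refine (isCompact_sideSet 1 univ).of_isClosed_subset isClosed_snakeFractal ?_
  rw [← levelSet_eq_sideSet]
  exact biInter_subset_of_mem (mem_Ici.2 le_rfl)

/-- The fractal is a decreasing intersection of compact connected levels: disjoint neighbourhoods of
two closed pieces would already contain, and so disconnect, some level. -/
lemma isPreconnected_snakeFractal : IsPreconnected snakeFractal := by
  rw [isPreconnected_closed_iff]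
  intro F G hF hG hFG hF' hG'
  by_contra hne
  rw [not_nonempty_iff_eq_empty] at hne
  have hdisj : Disjoint (snakeFractal ∩ F) (snakeFractal ∩ G) := by
    rw [disjoint_iff_inter_eq_empty, ← hne]
    ext z
    simp only [mem_inter_iff]
    tauto
  obtain ⟨U, V, hU, hV, hFU, hGV, hUV⟩ := SeparatedNhds.of_isCompact_isCompact
    (isCompact_snakeFractal.inter_right hF) (isCompact_snakeFractal.inter_right hG) hdisj
  have hinter : (⋂ n, levelSet snakeWidth snakeCross n) = snakeFractal := by
    ext z
    rw [mem_snakeFractal]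
    simp [levelSet]
  have hsub : snakeFractal ⊆ U ∪ V := fun z hz =>
    (hFG hz).imp (fun h => hFU ⟨hz, h⟩) (fun h => hGV ⟨hz, h⟩)
  obtain ⟨n, hn⟩ := exists_subset_nhds_of_isCompact (V := levelSet snakeWidth snakeCross)
    (directed_of_isDirected_le levelSet_antitone)
    (fun n => by rw [levelSet_eq_sideSet]; exact isCompact_sideSet n univ)
    (U := U ∪ V) (fun z hz => (hU.union hV).mem_nhds (hsub (hinter ▸ hz)))
  have hLn : snakeFractal ⊆ levelSet snakeWidth snakeCross n := by
    rw [← hinter]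
    exact iInter_subset _ n
  obtain ⟨x, hx⟩ := hF'
  obtain ⟨y, hy⟩ := hG'
  obtain ⟨z, -, hzU, hzV⟩ := isPreconnected_levelSet n U V hU hV hn ⟨x, hLn hx.1, hFU hx⟩
    ⟨y, hLn hy.1, hGV hy⟩
  exact hUV.le_bot ⟨hzU, hzV⟩

/-- On all sufficiently fine levels, two points of the fractal are separated by the middle of a
side of a square that contains the first point. -/
lemma exists_isCut_of_ne {x y : Plane} (hx : x ∈ snakeFractal) (hy : y ∈ snakeFractal)
    (hxy : x ≠ y) : ∃ n₀, ∀ n ≥ n₀, ∃ q ∈ snakeSquares n, ∃ d C, IsDir d ∧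
      q + d ∈ snakeSquares n ∧ IsCut (snakeSquares n) q (q + d) C ∧
      x ∈ gridSquare (snakeTotal n) q ∧ x ≠ midpointOf (snakeTotal n) q (q + d) ∧
      y ≠ midpointOf (snakeTotal n) q (q + d) ∧ y ∈ sideSet n C := by
  obtain ⟨n₀, hn₀⟩ := exists_level_notMem hxy
  refine ⟨n₀, fun n hn => ?_⟩
  have hcon := gridConnected_snakeSquares n
  have hacy := gridAcyclic_snakeSquares n
  obtain ⟨r, hr, hyr⟩ := mem_snakeFractal.1 hy n
  have key : ∀ q ∈ snakeSquares n, x ∈ gridSquare (snakeTotal n) q → ∃ d C, IsDir d ∧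
      q + d ∈ snakeSquares n ∧ IsCut (snakeSquares n) q (q + d) C ∧
      y ≠ midpointOf (snakeTotal n) q (q + d) ∧ r ∈ C := by
    intro q hq hxq
    have hyq := hn₀ n hn q hxq
    obtain ⟨d, C, hd, hqd, hC, hrC⟩ := hcon.exists_dir hacy hq hr (fun e => hyq (e ▸ hyr))
    refine ⟨d, C, hd, hqd, hC, fun e => hyq ?_, hrC⟩
    rw [e]
    exact midpointOf_mem (by simpa using hd)
  obtain ⟨q, hq, hxq⟩ := mem_snakeFractal.1 hx n
  obtain ⟨d, C, hd, hqd, hC, hyd, hrC⟩ := key q hq hxq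
  -- If `x` is itself the cut point, pass to the square `q + d` across it. The edge leading from
  -- there to `y` is not the same one reversed, since the two sides of a bridge are disjoint; its
  -- middle is therefore not `x`.
  by_cases hxd : x = midpointOf (snakeTotal n) q (q + d)
  · have hxq' : x ∈ gridSquare (snakeTotal n) (q + d) := by
      rw [hxd]
      exact midpointOf_mem_right (by simpa using hd)
    obtain ⟨e, C', he, hqe, hC', hye, hrC'⟩ := key _ hqd hxq'
    refine ⟨q + d, hqd, e, C', he, hqe, hC', hxq', fun hxe => ?_, hye,
      mem_sideSet.2 ⟨r, hr, hrC', hyr⟩⟩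
    have hde : e = -d := by
      refine midpointOf_add_injective (n := n) (q := q + d) ?_
      rw [← hxe, hxd, midpointOf_comm]
      simp
    subst hde
    rw [add_neg_cancel_right] at hC'
    exact hcon.disjoint_of_isCut hq hr hC hC' hrC hrC'
  · exact ⟨q, hq, d, C, hd, hqd, hC, hxq, hxd, hyd, mem_sideSet.2 ⟨r, hr, hrC, hyr⟩⟩

/-- The middles of the edges of the grids, as points of the fractal. -/
def edgePoints : Set snakeFractal :=
  {p | ∃ n a b, (p : Plane) = midpointOf (snakeTotal n) a b}

lemma countable_edgePoints : edgePoints.Countable := by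
  have : (range fun s : ℕ × (ℤ × ℤ) × (ℤ × ℤ) =>
      midpointOf (snakeTotal s.1) s.2.1 s.2.2).Countable :=
    countable_range _
  refine (this.preimage_of_injOn (f := ((↑) : snakeFractal → Plane)) Subtype.val_injective.injOn).mono
    ?_
  rintro p ⟨n, a, b, h⟩
  exact ⟨⟨n, a, b⟩, h.symm⟩

/-- The two sides of a cut are closed, cover the fractal and share only the edge middle, so their
complements form the splitting. The middle lies in the fractal because the fractal is connected. -/
lemma exists_separates_edgePoints (x y : snakeFractal) (hxy : x ≠ y) :
    ∃ p ∈ edgePoints, Separates p x y := by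
  obtain ⟨n, hn⟩ := exists_isCut_of_ne x.2 y.2 (fun h => hxy (Subtype.ext h))
  obtain ⟨q, hq, d, C, hd, hqd, hC, hxq, hxd, hyd, hyC⟩ := hn n le_rfl
  have hxC : (x : Plane) ∈ sideSet n Cᶜ := mem_sideSet.2 ⟨q, hq, hC.notMem, hxq⟩
  have hp := hC.cutPoint_mem isPreconnected_snakeFractal subset_rfl x.2 hxC y.2 hyC
  have hd' : IsDir (q + d - q) := by simpa using hd
  refine ⟨⟨_, hp⟩, ⟨n, q, q + d, rfl⟩, (↑) ⁻¹' (sideSet n C)ᶜ, (↑) ⁻¹' (sideSet n Cᶜ)ᶜ,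
    ⟨?_, ?_, ?_, ?_⟩, ?_, ?_⟩
  · exact (isClosed_sideSet n C).isOpen_compl.preimage continuous_subtype_val
  · exact (isClosed_sideSet n Cᶜ).isOpen_compl.preimage continuous_subtype_val
  · rw [disjoint_left]
    intro z h1 h2
    exact (snakeFractal_subset_sideSet_union n C z.2).elim h1 h2
  · ext z
    constructor
    · rintro h rfl
      rcases h with h | h
      · exact h (mem_sideSet.2 ⟨_, hqd, hC.mem, midpointOf_mem_right hd'⟩)
      · exact h (mem_sideSet.2 ⟨_, hq, hC.notMem, midpointOf_mem hd'⟩)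
    · intro hz
      by_contra h
      rw [mem_union, not_or] at h
      exact hz (Subtype.ext (hC.eq_midpointOf z.2 (not_not.1 h.1) (not_not.1 h.2)))
  · exact fun h => hxd (hC.eq_midpointOf x.2 h hxC)
  · exact fun h => hyd (hC.eq_midpointOf y.2 hyC h)

/-- Any two points of the fractal are joined by a unique arc in the fractal. -/
theorem existsUnique_isArc {x y : Plane} (hx : x ∈ snakeFractal) (hy : y ∈ snakeFractal)
    (hxy : x ≠ y) : ∃! a : Set Plane, IsArc x y a ∧ a ⊆ snakeFractal := by
  have : CompactSpace snakeFractal := isCompact_iff_compactSpace.1 isCompact_snakeFractal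
  have : PreconnectedSpace snakeFractal :=
    isPreconnected_iff_preconnectedSpace.1 isPreconnected_snakeFractal
  obtain ⟨γ, hγ⟩ := exists_injective_path countable_edgePoints exists_separates_edgePoints
    (x := ⟨x, hx⟩) (y := ⟨y, hy⟩) (fun h => hxy (congrArg Subtype.val h))
  refine ⟨(↑) '' closure (separators edgePoints (⟨x, hx⟩ : snakeFractal) ⟨y, hy⟩), ⟨?_, ?_⟩, ?_⟩
  · refine ⟨γ.map continuous_subtype_val, Subtype.val_injective.comp hγ, ?_⟩
    rw [← range_eq_closure_separators exists_separates_edgePoints γ hγ, ← range_comp]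
    rfl
  · rintro _ ⟨z, -, rfl⟩
    exact z.2
  · rintro a ⟨⟨δ, hδ, rfl⟩, hδL⟩
    let δ' : Path (⟨x, hx⟩ : snakeFractal) ⟨y, hy⟩ :=
      ⟨⟨fun t => ⟨δ t, hδL ⟨t, rfl⟩⟩, by fun_prop⟩, Subtype.ext δ.source, Subtype.ext δ.target⟩
    have hδ' : Function.Injective δ' := fun s t h => hδ (congrArg Subtype.val h)
    rw [← range_eq_closure_separators exists_separates_edgePoints δ' hδ', ← range_comp]
    rfl

end Topology

/-! ### Crossed squares and coverings by discs -/

section Counting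

/-- The white squares of level `n` with the middles of two of their sides in `a`. -/
def crossedSquares (n : ℕ) (a : Set Plane) : Set (ℤ × ℤ) :=
  {q ∈ snakeSquares n | ∃ d e, IsDir d ∧ IsDir e ∧ d ≠ e ∧
    midpointOf (snakeTotal n) q (q + d) ∈ a ∧ midpointOf (snakeTotal n) q (q + e) ∈ a}

variable {a : Set Plane}

lemma finite_crossedSquares (n : ℕ) (a : Set Plane) : (crossedSquares n a).Finite :=
  (finite_snakeSquares n).subset (sep_subset _ _)

/-- A connected set that crosses a square from the side `d` to another one crosses all the squares
inside that are passed on the way to the exit at `d`. -/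
lemma subSquare_mem_crossedSquares (ha : IsPreconnected a) (haL : a ⊆ snakeFractal) {n : ℕ}
    {q d e w : ℤ × ℤ} (hq : q ∈ snakeSquares n) (hd : IsDir d) (he : IsDir e) (hde : d ≠ e)
    (hqd : midpointOf (snakeTotal n) q (q + d) ∈ a)
    (hqe : midpointOf (snakeTotal n) q (q + e) ∈ a)
    (hw : IsPassage (snakeHalf n) (snakeCross (n + 1)) d w) :
    subSquare (snakeHalf n) q w ∈ crossedSquares (n + 1) a := by
  obtain ⟨hwA, f, hf, hpass⟩ := hw
  have hA := isCross_succ n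
  have hmem : ∀ {u}, u ∈ snakeCross (n + 1) →
      subSquare (snakeHalf n) q u ∈ snakeSquares (n + 1) := fun {u} hu => by
    rw [snakeSquares_succ]
    exact ⟨q, hq, u, hu, rfl⟩
  -- The middle of side `d` lies in the exit subsquare inside the cut, that of side `e` in one
  -- outside it. The connected set `a` contains both, hence also the cut point.
  have hcut : ∀ u ∈ snakeCross (n + 1), ∀ v ∈ snakeCross (n + 1), ∀ C,
      IsCut (snakeCross (n + 1)) u v C →
      (∀ e', IsDir e' → (exitSquare (snakeHalf n) e' ∈ C ↔ e' = d)) →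
      midpointOf (snakeTotal (n + 1)) (subSquare (snakeHalf n) q u) (subSquare (snakeHalf n) q v)
        ∈ a := by
    intro u hu v hv C hC hexit
    obtain ⟨C', hC', hCC'⟩ := hA.exists_isCut_substitution (gridAcyclic_snakeSquares n) hq hu hv
      hC hd hexit
    rw [← snakeSquares_succ] at hC'
    have hed := hA.exit_mem d hd
    have hee := hA.exit_mem e he
    refine hC'.cutPoint_mem ha haL hqe ?_ hqd ?_
    · refine mem_sideSet.2 ⟨_, hmem hee, ?_, midpointOf_mem_exitSquare he⟩
      rw [mem_compl_iff, hCC' _ hee, hexit e he]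
      exact hde.symm
    · refine mem_sideSet.2 ⟨_, hmem hed, ?_, midpointOf_mem_exitSquare hd⟩
      rw [hCC' _ hed, hexit d hd]
  have hside : ∀ s, s = f ∨ s = -f → midpointOf (snakeTotal (n + 1)) (subSquare (snakeHalf n) q w)
      (subSquare (snakeHalf n) q w + s) ∈ a := by
    intro s hs
    obtain ⟨hws, C, hC | hC, hexit⟩ := hpass s hs
    · rw [← subSquare_add]
      exact hcut w hwA _ hws C hC hexit
    · rw [← subSquare_add, midpointOf_comm]
      exact hcut _ hws w hwA C hC hexit
  exact ⟨hmem hwA, f, -f, hf, hf.neg, hf.ne_neg, hside f (Or.inl rfl), hside (-f) (Or.inr rfl)⟩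

/-- Level `n + 1` uses the pattern with index `n + 1`, whose passages number at least `((n + 1) - 1)
^ 2` for each exit. -/
lemma sq_mul_ncard_crossedSquares_le (ha : IsPreconnected a) (haL : a ⊆ snakeFractal) (n : ℕ) :
    n ^ 2 * (crossedSquares n a).ncard ≤ (crossedSquares (n + 1) a).ncard := by
  classical
  have hT : ∀ q : ℤ × ℤ, ∃ T : Finset (ℤ × ℤ), q ∈ crossedSquares n a → n ^ 2 ≤ T.card ∧
      ∀ w ∈ T, w ∈ snakeCross (n + 1) ∧
        subSquare (snakeHalf n) q w ∈ crossedSquares (n + 1) a := by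
    intro q
    by_cases hq : q ∈ crossedSquares n a
    · obtain ⟨hqW, d, e, hd, he, hde, hqd, hqe⟩ := hq
      obtain ⟨T, hcard, hT⟩ := exists_finset_isPassage (n + 1) hd
      exact ⟨T, fun _ => ⟨by simpa using hcard, fun w hw => ⟨(hT w hw).1,
        subSquare_mem_crossedSquares ha haL hqW hd he hde hqd hqe (hT w hw)⟩⟩⟩
    · exact ⟨∅, fun h => absurd h hq⟩
  choose T hT using hT
  set F := (finite_crossedSquares n a).toFinset with hF
  have hmemF : ∀ q, q ∈ F ↔ q ∈ crossedSquares n a := fun q => by simp [hF]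
  let g : (Σ _ : ℤ × ℤ, ℤ × ℤ) → ℤ × ℤ := fun s => subSquare (snakeHalf n) s.1 s.2
  have hinj : InjOn g (F.sigma T) := by
    rintro ⟨q, w⟩ hs ⟨r, v⟩ ht h
    simp only [Finset.coe_sigma, mem_sigma_iff, Finset.mem_coe] at hs ht
    obtain ⟨rfl, rfl⟩ := (isCross_succ n).subSquare_inj
      ((hT q ((hmemF q).1 hs.1)).2 w hs.2).1 ((hT r ((hmemF r).1 ht.1)).2 v ht.2).1 h
    rfl
  have hsub : (((F.sigma T).image g : Finset (ℤ × ℤ)) : Set (ℤ × ℤ)) ⊆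
      crossedSquares (n + 1) a := by
    intro c hc
    obtain ⟨⟨q, w⟩, hs, rfl⟩ := Finset.mem_image.1 (Finset.mem_coe.1 hc)
    rw [Finset.mem_sigma] at hs
    exact ((hT q ((hmemF q).1 hs.1)).2 w hs.2).2
  calc n ^ 2 * (crossedSquares n a).ncard = ∑ _q ∈ F, n ^ 2 := by
        rw [Finset.sum_const, smul_eq_mul, mul_comm, ncard_eq_toFinset_card _
          (finite_crossedSquares n a)]
    _ ≤ ∑ q ∈ F, (T q).card := Finset.sum_le_sum fun q hq => (hT q ((hmemF q).1 hq)).1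
    _ = ((F.sigma T).image g).card := by
        rw [Finset.card_image_of_injOn hinj, Finset.card_sigma]
    _ ≤ _ := by
        rw [← ncard_coe_finset]
        exact ncard_le_ncard hsub (finite_crossedSquares _ _)

/-- A connected part of the fractal with two points crosses squares of all fine levels. -/
lemma exists_crossedSquares_nonempty (ha : IsPreconnected a) (haL : a ⊆ snakeFractal) {x y : Plane}
    (hx : x ∈ a) (hy : y ∈ a) (hxy : x ≠ y) : ∃ n₀, ∀ n ≥ n₀, (crossedSquares n a).Nonempty := by
  obtain ⟨n₁, h₁⟩ := exists_isCut_of_ne (haL hx) (haL hy) hxy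
  obtain ⟨q, hq, d, C, hd, hqd, hC, hxq, hxd, hyd, hyC⟩ := h₁ n₁ le_rfl
  have hp := hC.cutPoint_mem ha haL hx (mem_sideSet.2 ⟨q, hq, hC.notMem, hxq⟩) hy hyC
  set p := midpointOf (snakeTotal n₁) q (q + d) with hpdef
  -- The point `p` of `a` stays the middle of a side on all finer levels. On such a level,
  -- separating `p` from `y` gives a second side middle in `a`, different from `p`, on a square that
  -- contains `p`.
  have hpgrid : OnGrid n₁ p := onGrid_midpointOf hd
  obtain ⟨n₂, h₂⟩ := exists_isCut_of_ne (haL hp) (haL hy) hyd.symm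
  refine ⟨max n₁ n₂, fun n hn => ?_⟩
  obtain ⟨r, hr, e, C', he, hre, hC', hpr, hpe, hye, hyC'⟩ := h₂ n ((le_max_right _ _).trans hn)
  have hp' := hC'.cutPoint_mem ha haL hp (mem_sideSet.2 ⟨r, hr, hC'.notMem, hpr⟩) hy hyC'
  obtain ⟨f, hf, hpf⟩ := (hpgrid.mono ((le_max_left _ _).trans hn)).exists_eq_midpointOf (haL hp) hpr
  refine ⟨r, hr, e, f, he, hf, ?_, hp', hpf ▸ hp⟩
  rintro rfl
  exact hpe hpf

lemma abs_apply_sub_le (x y : Plane) (i : Fin 2) : |x i - y i| ≤ dist x y := by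
  rw [dist_eq_norm, ← Real.norm_eq_abs]
  exact PiLp.norm_apply_le (x - y) i

/-- A disc that is not larger than the squares of level `n` meets at most sixteen of them. -/
lemma ncard_crossedSquares_le {n : ℕ} {δ : ℝ≥0} (hδ : snakeTotal n * (δ : ℝ) ≤ 1)
    {C : Finset Plane} (hC : Metric.IsCover δ a C) :
    (crossedSquares n a).ncard ≤ 16 * C.card := by
  classical
  -- A crossed square is charged to a disc that covers one of its side middles. In scaled
  -- coordinates that point is within `1` of the centre, which leaves four columns and four rows.
  let B : Plane → Finset (ℤ × ℤ) := fun c =>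
    Finset.Icc (⌊snakeTotal n * c 0⌋ - 2) (⌊snakeTotal n * c 0⌋ + 1) ×ˢ
      Finset.Icc (⌊snakeTotal n * c 1⌋ - 2) (⌊snakeTotal n * c 1⌋ + 1)
  have hB : ∀ c, (B c).card = 16 := by
    intro c
    simp only [B, Finset.card_product, Int.card_Icc]
    have : ∀ z : ℤ, (z + 1 + 1 - (z - 2)).toNat = 4 := fun z => by omega
    rw [this, this]
  have hsub : crossedSquares n a ⊆ (C.biUnion B : Finset (ℤ × ℤ)) := by
    rintro q ⟨hq, d, e, hd, he, hde, hqd, hqe⟩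
    obtain ⟨c, hc, hdist⟩ := hC hqd
    have hmem : midpointOf (snakeTotal n) q (q + d) ∈ gridSquare (snakeTotal n) q :=
      midpointOf_mem (by simpa using hd)
    set p := midpointOf (snakeTotal n) q (q + d)
    rw [mem_gridSquare] at hmem
    have hdist' : dist p c ≤ δ := by
      have h1 : edist p c ≤ δ := hdist
      rw [edist_nndist] at h1
      exact_mod_cast h1
    have hi : ∀ i, |snakeTotal n * p i - snakeTotal n * c i| ≤ 1 := by
      intro i
      rw [← mul_sub, abs_mul, abs_of_pos (snakeTotal_pos_real n)]
      exact (mul_le_mul_of_nonneg_left ((abs_apply_sub_le p c i).trans hdist')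
        (snakeTotal_pos_real n).le).trans hδ
    have h0 := abs_le.1 (hi 0)
    have h1 := abs_le.1 (hi 1)
    have key : ∀ (z : ℤ) (s t : ℝ), (z : ℝ) ≤ s → s ≤ z + 1 → -1 ≤ s - t → s - t ≤ 1 →
        ⌊t⌋ - 2 ≤ z ∧ z ≤ ⌊t⌋ + 1 := by
      intro z s t h1 h2 h3 h4
      constructor
      · have : ((⌊t⌋ - 2 : ℤ) : ℝ) ≤ z := by
          push_cast
          linarith [Int.floor_le t]
        exact_mod_cast this
      · have : z - 1 ≤ ⌊t⌋ := by
          rw [Int.le_floor]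
          push_cast
          linarith
        linarith
    simp only [B, Finset.coe_biUnion, mem_iUnion, Finset.mem_coe, Finset.mem_product,
      Finset.mem_Icc]
    exact ⟨c, hc, key _ _ _ hmem.1.1 hmem.1.2 h0.1 h0.2, key _ _ _ hmem.2.1 hmem.2.2 h1.1 h1.2⟩
  calc (crossedSquares n a).ncard ≤ ((C.biUnion B : Finset (ℤ × ℤ)) : Set (ℤ × ℤ)).ncard :=
        ncard_le_ncard hsub (Finset.finite_toSet _)
    _ = (C.biUnion B).card := ncard_coe_finset _
    _ ≤ ∑ c ∈ C, (B c).card := Finset.card_biUnion_le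
    _ = 16 * C.card := by simp [hB, mul_comm]

lemma mem_unit_of_mem_snakeFractal {z : Plane} (hz : z ∈ snakeFractal) (i : Fin 2) :
    0 ≤ z i ∧ z i ≤ 1 := by
  obtain ⟨q, hq, hzq⟩ := mem_snakeFractal.1 hz 0
  obtain rfl : q = (0, 0) := hq
  rw [mem_gridSquare] at hzq
  simp only [snakeTotal, totalWidth, Finset.Icc_eq_empty_of_lt zero_lt_one, Finset.prod_empty,
    Nat.cast_one, one_mul, Int.cast_zero, zero_add] at hzq
  fin_cases i
  · exact hzq.1
  · exact hzq.2

/-- A part of the unit square is covered by `9 / δ ^ 2` discs of radius `δ`. -/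
lemma exists_cover {δ : ℝ≥0} (h0 : 0 < δ) (h1 : δ ≤ 1) (haL : a ⊆ snakeFractal) :
    ∃ C : Finset Plane, Metric.IsCover δ a C ∧ (C.card : ℝ) ≤ 9 / (δ : ℝ) ^ 2 := by
  classical
  have h0' : (0 : ℝ) < δ := h0
  have h1' : (δ : ℝ) ≤ 1 := h1
  -- Centres on a lattice of mesh `δ / 2`: rounding down moves each coordinate by at most `δ / 2`,
  -- and there are `m + 1 ≤ 3 / δ` values per coordinate.
  set m := ⌊2 / (δ : ℝ)⌋₊ with hm
  let g : ℕ × ℕ → Plane := fun s => !₂[(s.1 : ℝ) * (δ / 2), (s.2 : ℝ) * (δ / 2)]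
  refine ⟨(Finset.range (m + 1) ×ˢ Finset.range (m + 1)).image g, ?_, ?_⟩
  · intro z hz
    have hfl : ∀ i, ⌊z i / (δ / 2)⌋₊ ∈ Finset.range (m + 1) ∧
        |z i - ⌊z i / (δ / 2)⌋₊ * (δ / 2 : ℝ)| ≤ δ / 2 := by
      intro i
      obtain ⟨hz0, hz1⟩ := mem_unit_of_mem_snakeFractal (haL hz) i
      have hnn : 0 ≤ z i / (δ / 2 : ℝ) := by positivity
      constructor
      · rw [Finset.mem_range, Nat.lt_succ_iff, hm]
        refine Nat.floor_le_floor ?_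
        rw [div_div_eq_mul_div]
        gcongr
        linarith
      · have h2 := Nat.floor_le hnn
        have h3 := (Nat.lt_floor_add_one (z i / (δ / 2 : ℝ))).le
        rw [le_div_iff₀ (by positivity)] at h2
        rw [div_le_iff₀ (by positivity)] at h3
        rw [abs_le]
        constructor <;> linarith
    refine ⟨g (⌊z 0 / (δ / 2)⌋₊, ⌊z 1 / (δ / 2)⌋₊), ?_, ?_⟩
    · exact Finset.mem_coe.2 (Finset.mem_image_of_mem _
        (Finset.mem_product.2 ⟨(hfl 0).1, (hfl 1).1⟩))
    · have hdist : dist z (g (⌊z 0 / (δ / 2)⌋₊, ⌊z 1 / (δ / 2)⌋₊)) ≤ δ := by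
        rw [EuclideanSpace.dist_eq, Fin.sum_univ_two, Real.sqrt_le_left h0'.le]
        simp only [Real.dist_eq, g, Matrix.cons_val_zero, Matrix.cons_val_one]
        have h2 := pow_le_pow_left₀ (abs_nonneg _) (hfl 0).2 2
        have h3 := pow_le_pow_left₀ (abs_nonneg _) (hfl 1).2 2
        nlinarith
      change edist _ _ ≤ _
      rw [edist_nndist]
      exact_mod_cast hdist
  · calc (((Finset.range (m + 1) ×ˢ Finset.range (m + 1)).image g).card : ℝ)
        ≤ ((Finset.range (m + 1) ×ˢ Finset.range (m + 1)).card : ℝ) := by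
          exact_mod_cast Finset.card_image_le
      _ = ((m : ℝ) + 1) ^ 2 := by
          rw [Finset.card_product, Finset.card_range]
          push_cast
          ring
      _ ≤ (3 / δ) ^ 2 := by
          have h2 : (m : ℝ) ≤ 2 / δ := Nat.floor_le (by positivity)
          have h3 : 1 ≤ 1 / (δ : ℝ) := by rw [le_div_iff₀ h0']; linarith
          have h4 : (3 : ℝ) / δ = 2 / δ + 1 / δ := by ring
          rw [h4]
          gcongr
      _ = 9 / (δ : ℝ) ^ 2 := by ring

end Counting

/-! ### From counting crossed squares to the box dimension -/

section Dimension

variable {a : Set Plane}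

/-- The number of crossed squares grows faster than any power less than two of the width of the
next grid. -/
lemma exists_le_ncard_crossedSquares (ha : IsPreconnected a) (haL : a ⊆ snakeFractal)
    {x y : Plane} (hx : x ∈ a) (hy : y ∈ a) (hxy : x ≠ y) {s : ℝ} (hs0 : 0 ≤ s) (hs : s < 2) :
    ∃ c > 0, ∃ n₁, ∀ n ≥ n₁,
      c * (snakeTotal (n + 1) : ℝ) ^ s ≤ (crossedSquares n a).ncard := by
  obtain ⟨n₀, hn₀⟩ := exists_crossedSquares_nonempty ha haL hx hy hxy
  -- The factor `n ^ 2` gained from level `n` to `n + 1` is compared with the width `4 n + 15` of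
  -- the pattern `n + 2`, as the claim runs one level ahead. The width is at most `19 n`, and `n ^
  -- (2 - s)` eventually exceeds `19 ^ s`.
  have hev : ∀ᶠ n : ℕ in atTop, (snakeWidth (n + 2) : ℝ) ^ s ≤ (n : ℝ) ^ 2 := by
    have h1 : Tendsto (fun n : ℕ => (n : ℝ) ^ (2 - s)) atTop atTop :=
      (tendsto_rpow_atTop (by linarith)).comp tendsto_natCast_atTop_atTop
    filter_upwards [h1.eventually_ge_atTop ((19 : ℝ) ^ s), eventually_ge_atTop 1] with n hn hn1
    have hn1' : (1 : ℝ) ≤ n := by exact_mod_cast hn1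
    have hw : (snakeWidth (n + 2) : ℝ) ≤ 19 * n := by
      simp only [snakeWidth]
      push_cast
      linarith
    calc (snakeWidth (n + 2) : ℝ) ^ s ≤ (19 * n) ^ s := by gcongr
      _ = 19 ^ s * (n : ℝ) ^ s := Real.mul_rpow (by norm_num) (by positivity)
      _ ≤ (n : ℝ) ^ (2 - s) * (n : ℝ) ^ s := by gcongr
      _ = (n : ℝ) ^ 2 := by
        rw [← Real.rpow_add (by linarith), sub_add_cancel, Real.rpow_two]
  obtain ⟨n₁, hn₁⟩ := eventually_atTop.1 hev
  set N := max n₀ n₁ with hN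
  have hMpos : ∀ n, 0 < (snakeTotal n : ℝ) ^ s := fun n =>
    Real.rpow_pos_of_pos (snakeTotal_pos_real n) s
  -- With this constant the base case just asks for one crossed square of level `N`.
  refine ⟨1 / (snakeTotal (N + 1) : ℝ) ^ s, one_div_pos.2 (hMpos _), N, fun n hn => ?_⟩
  induction n, hn using Nat.le_induction with
  | base =>
    rw [one_div, inv_mul_cancel₀ (hMpos _).ne']
    have := (ncard_pos (finite_crossedSquares N a)).2 (hn₀ N (le_max_left _ _))
    exact_mod_cast this
  | succ n hn ih =>
    have h1 := hn₁ n ((le_max_right _ _).trans hn)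
    have h2 : ((n : ℝ) ^ 2) * (crossedSquares n a).ncard ≤ (crossedSquares (n + 1) a).ncard := by
      exact_mod_cast sq_mul_ncard_crossedSquares_le ha haL n
    have hc : 0 ≤ 1 / (snakeTotal (N + 1) : ℝ) ^ s := (one_div_pos.2 (hMpos _)).le
    calc 1 / (snakeTotal (N + 1) : ℝ) ^ s * (snakeTotal (n + 1 + 1) : ℝ) ^ s
        = (snakeWidth (n + 2) : ℝ) ^ s *
          (1 / (snakeTotal (N + 1) : ℝ) ^ s * (snakeTotal (n + 1) : ℝ) ^ s) := by
          rw [snakeTotal_succ (n + 1), Nat.cast_mul,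
            Real.mul_rpow (Nat.cast_nonneg _) (Nat.cast_nonneg _)]
          ring
      _ ≤ (n : ℝ) ^ 2 * (crossedSquares n a).ncard := by
          gcongr
      _ ≤ _ := h2

/-- The covering numbers of a connected set with two points in the fractal. -/
lemma exists_le_card_of_isCover (ha : IsPreconnected a) (haL : a ⊆ snakeFractal)
    {x y : Plane} (hx : x ∈ a) (hy : y ∈ a) (hxy : x ≠ y) {s : ℝ} (hs0 : 0 ≤ s) (hs : s < 2) :
    ∃ c > 0, ∃ ε > 0, ∀ δ : ℝ≥0, 0 < δ → (δ : ℝ) ≤ ε → ∀ C : Finset Plane, Metric.IsCover δ a C →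
      c * (δ : ℝ)⁻¹ ^ s ≤ C.card := by
  obtain ⟨c, hc, n₁, hn₁⟩ := exists_le_ncard_crossedSquares ha haL hx hy hxy hs0 hs
  refine ⟨c / 16, by positivity, 1 / snakeTotal n₁, one_div_pos.2 (snakeTotal_pos_real _), ?_⟩
  intro δ hδ hδε C hC
  have hδ' : (0 : ℝ) < δ := hδ
  -- The level with `1 / m(n + 1) < δ ≤ 1 / m(n)`: discs are small enough for the count at level
  -- `n`, while `δ⁻¹` may be as large as the next width.
  obtain ⟨n, hn, hle, hlt⟩ : ∃ n ≥ n₁, snakeTotal n * (δ : ℝ) ≤ 1 ∧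
      1 < snakeTotal (n + 1) * (δ : ℝ) := by
    by_contra hcon
    push Not at hcon
    have hall : ∀ n ≥ n₁, snakeTotal n * (δ : ℝ) ≤ 1 := by
      intro n hn
      induction n, hn using Nat.le_induction with
      | base => rwa [le_div_iff₀ (snakeTotal_pos_real _), mul_comm] at hδε
      | succ n hn ih => exact hcon n hn ih
    obtain ⟨n, h1, h2⟩ := ((tendsto_snakeTotal.atTop_mul_const hδ').eventually_gt_atTop 1 |>.and
      (eventually_ge_atTop n₁)).exists
    exact absurd (hall n h2) (not_le.2 h1)
  have h1 := hn₁ n hn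
  have h2 : ((crossedSquares n a).ncard : ℝ) ≤ 16 * C.card := by
    exact_mod_cast ncard_crossedSquares_le hle hC
  have h3 : (δ : ℝ)⁻¹ ^ s ≤ (snakeTotal (n + 1) : ℝ) ^ s := by
    refine Real.rpow_le_rpow (by positivity) ?_ hs0
    rw [inv_le_iff_one_le_mul₀ hδ']
    exact hlt.le
  have h4 := mul_le_mul_of_nonneg_left h3 hc.le
  linarith

/-- A function between constant multiples of `δ⁻¹ ^ s`, for all `s < 2`, and of `δ⁻¹ ^ 2` grows
with exponent `2`. -/
lemma tendsto_log_div_of_bounds {k : ℝ≥0 → ℝ}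
    (hlow : ∀ s : ℝ, 0 ≤ s → s < 2 → ∃ c > 0, ∀ᶠ δ : ℝ≥0 in 𝓝[>] 0, c * (δ : ℝ)⁻¹ ^ s ≤ k δ)
    (hup : ∀ᶠ δ : ℝ≥0 in 𝓝[>] 0, k δ ≤ 9 / (δ : ℝ) ^ 2) :
    Tendsto (fun δ : ℝ≥0 => Real.log (k δ) / -Real.log δ) (𝓝[>] 0) (𝓝 2) := by
  have hcoe : Tendsto (fun δ : ℝ≥0 => (δ : ℝ)) (𝓝[>] 0) (𝓝[>] 0) := by
    refine tendsto_nhdsWithin_iff.2 ⟨?_, ?_⟩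
    · exact (NNReal.continuous_coe.tendsto' 0 0 rfl).mono_left nhdsWithin_le_nhds
    · filter_upwards [self_mem_nhdsWithin] with δ hδ
      exact hδ
  have hL : Tendsto (fun δ : ℝ≥0 => -Real.log δ) (𝓝[>] 0) atTop :=
    tendsto_neg_atBot_atTop.comp (Real.tendsto_log_nhdsGT_zero.comp hcoe)
  have hlim : ∀ b t : ℝ, Tendsto (fun δ : ℝ≥0 => b / -Real.log δ + t) (𝓝[>] 0) (𝓝 t) := by
    intro b t
    simpa using (hL.const_div_atTop b).add_const t
  have hpos : ∀ᶠ δ : ℝ≥0 in 𝓝[>] 0, 0 < δ := self_mem_nhdsWithin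
  -- The exponent `0` merely bounds `k` away from zero, as needed for the logarithm in the upper
  -- estimate.
  obtain ⟨c₀, hc₀, hk₀⟩ := hlow 0 le_rfl two_pos
  refine tendsto_order.2 ⟨fun b hb => ?_, fun b hb => ?_⟩
  -- An exponent strictly between `b` and `2`, replaced by `0` if negative.
  · have hs : b < max ((b + 2) / 2) 0 := lt_max_of_lt_left (by linarith)
    obtain ⟨c, hc, hk⟩ := hlow (max ((b + 2) / 2) 0) (le_max_right _ _)
      (max_lt (by linarith) two_pos)
    filter_upwards [(hlim (Real.log c) _).eventually_const_lt hs, hL.eventually_gt_atTop 0, hk, hpos]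
      with δ h1 h2 h3 h4
    refine h1.trans_le ?_
    have h4' : (0 : ℝ) < δ := h4
    have h5 := Real.log_le_log (by positivity) h3
    rw [Real.log_mul hc.ne' (by positivity), Real.log_rpow (by positivity), Real.log_inv] at h5
    rw [div_add' _ _ _ h2.ne']
    gcongr
  · filter_upwards [(hlim (Real.log 9) 2).eventually_lt_const hb, hL.eventually_gt_atTop 0, hup, hk₀,
      hpos] with δ h1 h2 h3 h3' h4
    refine lt_of_le_of_lt ?_ h1
    have h4' : (0 : ℝ) < δ := h4
    have hkpos : 0 < k δ := by
      rw [Real.rpow_zero, mul_one] at h3'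
      linarith
    have h5 := Real.log_le_log hkpos h3
    rw [Real.log_div (by norm_num) (by positivity), Real.log_pow] at h5
    rw [div_add' _ _ _ h2.ne']
    gcongr
    push_cast at h5
    linarith

/-- The least covers of a bounded part of the plane are finite. -/
lemma exists_finset_card_eq_externalCoveringNumber {δ : ℝ≥0} {C₀ : Finset Plane}
    (hC₀ : Metric.IsCover δ a C₀) : ∃ C : Finset Plane, Metric.IsCover δ a C ∧
      Metric.externalCoveringNumber δ a = C.card ∧ C.card ≤ C₀.card := by
  have : Nonempty {C : Set Plane // Metric.IsCover δ a C} := ⟨⟨C₀, hC₀⟩⟩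
  obtain ⟨⟨C, hCc⟩, hC⟩ := ENat.exists_eq_iInf
    (fun C : {C : Set Plane // Metric.IsCover δ a C} => (C : Set Plane).encard)
  rw [iInf_subtype] at hC
  change C.encard = Metric.externalCoveringNumber δ a at hC
  have hle : C.encard ≤ C₀.card := by
    rw [hC, ← encard_coe_eq_coe_finsetCard]
    exact hC₀.externalCoveringNumber_le_encard
  have hfin : C.Finite := finite_of_encard_le_coe hle
  lift C to Finset Plane using hfin
  rw [encard_coe_eq_coe_finsetCard] at hC hle
  exact ⟨C, hCc, hC.symm, by exact_mod_cast hle⟩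

/-- A connected set with two points in the fractal has box-counting dimension two. -/
theorem hasBoxDim_of_isPreconnected (ha : IsPreconnected a) (haL : a ⊆ snakeFractal)
    {x y : Plane} (hx : x ∈ a) (hy : y ∈ a) (hxy : x ≠ y) : HasBoxDim a 2 := by
  let k : ℝ≥0 → ℕ := fun δ => (Metric.externalCoveringNumber δ a).toNat
  have hIoc : ∀ ε : ℝ≥0, 0 < ε → ∀ᶠ δ : ℝ≥0 in 𝓝[>] 0, 0 < δ ∧ δ ≤ ε := fun ε hε => by
    filter_upwards [Ioc_mem_nhdsGT hε] with δ hδ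
    exact hδ
  have hmin : ∀ δ : ℝ≥0, 0 < δ → δ ≤ 1 → ∃ C : Finset Plane, Metric.IsCover δ a C ∧
      Metric.externalCoveringNumber δ a = k δ ∧ C.card = k δ ∧ (k δ : ℝ) ≤ 9 / (δ : ℝ) ^ 2 := by
    intro δ h0 h1
    obtain ⟨C₀, hC₀, hcard⟩ := exists_cover h0 h1 haL
    obtain ⟨C, hC, hCn, hle⟩ := exists_finset_card_eq_externalCoveringNumber hC₀
    have hk : C.card = k δ := by simp only [k, hCn, ENat.toNat_natCast]
    refine ⟨C, hC, by rw [hCn, hk], hk, ?_⟩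
    rw [← hk]
    exact le_trans (by exact_mod_cast hle) hcard
  have hlim : Tendsto (fun δ : ℝ≥0 => Real.log (k δ) / -Real.log δ) (𝓝[>] 0) (𝓝 2) := by
    refine tendsto_log_div_of_bounds (fun s hs0 hs => ?_) ?_
    · obtain ⟨c, hc, ε, hε, h⟩ := exists_le_card_of_isCover ha haL hx hy hxy hs0 hs
      refine ⟨c, hc, ?_⟩
      filter_upwards [hIoc 1 one_pos, hIoc ⟨ε, hε.le⟩ hε] with δ h1 h2
      obtain ⟨C, hC, -, hk, -⟩ := hmin δ h1.1 h1.2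
      rw [← hk]
      exact h δ h1.1 h2.2 C hC
    · filter_upwards [hIoc 1 one_pos] with δ h1
      obtain ⟨C, -, -, -, h⟩ := hmin δ h1.1 h1.2
      exact h
  -- For small `δ` the covering number is finite, and nonzero because `x ∈ a`; so the extended
  -- logarithm is the real one.
  refine ((continuous_coe_real_ereal.tendsto 2).comp hlim).congr' ?_
  filter_upwards [hIoc 1 one_pos] with δ h1
  obtain ⟨C, hC, hN, hk, -⟩ := hmin δ h1.1 h1.2
  have hpos : k δ ≠ 0 := by
    have : 0 < Metric.externalCoveringNumber δ a :=
      Metric.externalCoveringNumber_pos_iff.2 ⟨x, hx⟩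
    rw [hN] at this
    exact (Nat.cast_pos.1 this).ne'
  have hlog : ENNReal.log ((Metric.externalCoveringNumber δ a : ℕ∞) : ℝ≥0∞) =
      ((Real.log (k δ) : ℝ) : EReal) := by
    rw [hN, ENat.toENNReal_coe, ENNReal.log_pos_real (by exact_mod_cast hpos)
      (ENNReal.natCast_ne_top _), ENNReal.toReal_natCast]
  rw [Function.comp_apply, hlog, EReal.coe_div]

end Dimension

end Labyrinth

theorem theorem3 (x y : Labyrinth.Plane) (hx : x ∈ Labyrinth.snakeFractal)
    (hy : y ∈ Labyrinth.snakeFractal) (hxy : x ≠ y) :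
    (∃! a : Set Labyrinth.Plane, Labyrinth.IsArc x y a ∧ a ⊆ Labyrinth.snakeFractal) ∧
    ∀ a : Set Labyrinth.Plane, Labyrinth.IsArc x y a → a ⊆ Labyrinth.snakeFractal →
      Labyrinth.HasBoxDim a 2 := by
  refine ⟨Labyrinth.existsUnique_isArc hx hy hxy, ?_⟩
  rintro _ ⟨γ, -, rfl⟩ haL
  exact Labyrinth.hasBoxDim_of_isPreconnected (isPreconnected_range γ.continuous) haL
    ⟨0, γ.source⟩ ⟨1, γ.target⟩ hxy
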